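/- Let $E$ be an interval exchange transformation of $\Omega=[0,1)$ with $N$ intervals $\Omega_1,\dots,\Omega_N$ (half-open, of positive lengths $|\Omega_i|$ with sum $1$) and translations $\tau_i$, so that $E(x)=x+\tau_i$ for $x\in\Omega_i$. Assume that its permutation is irreducible, that $E$ is uniquely ergodic, and that the lengths $|\Omega_i|$ generate an algebraic number field $K$ of degree $n$ over $\mathbb Q$. Let $\mathcal M=\sum_i\mathbb Z|\Omega_i|$ be the module of $E$, with a $\mathbb Z$-basis $(\nu_k)$. Assume that $E$ is renormalizable: there are an interval $I=[a,a+\rho)\subseteq[0,1)$, $0<\rho<1$, such that the first-return map of $E$ to $I$ is conjugate to $E$ by $S(x)=a+\rho x$, and a substitution $\sigma$ on $\{1,\dots,N\}$ such that for every $i$ the word $\sigma(i)$ is the common itinerary, through the intervals $\Omega_j$ and up to the first return to $I$, of all points of $S(\Omega_i)$. Let $M_\sigma$ be the incidence matrix of $\sigma$ (the entry $(i,j)$ is the number of letters $i$ in $\sigma(j)$), and let $R$ be the integral matrix of multiplication by $\rho$ on $\mathcal M$ in the basis $(\nu_k)$. Write $\|\cdot\|$ for the spectral radius. A prefix $\mu$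 is a proper, possibly empty, prefix of one of the words $\sigma(i)$ (labelled by $i$); put $\chi(\mu)=i$, let $\mu_+$ be the letter following $\mu$ in $\sigma(i)$, let $\tau_\mu$ be the sum of the $\tau_j$ over the letters $j$ of $\mu$, and let $f_\mu(x)=S(x)+\tau_\mu$. The Vershik code of $x\in\Omega$ is the sequence of prefixes $(\mu_k)_{k\ge1}$ with $\chi(\mu_k)=(\mu_{k+1})_+$ and $x\in f_{\mu_1}\circ\cdots\circ f_{\mu_k}(\Omega_{\chi(\mu_k)})$ for all $k\ge1$. The point $x$ is eventually periodic of period $T$ if $\mu_{k+T}=\mu_k$ for all sufficiently large $k$. Let $\Xi=\{\sum_k q_k\nu_k: q_k\in\mathbb Q\cap[0,1)\}$. For $\xi\in\Xi$, a set $A\subseteq(\xi+\mathcal M)\cap[0,1)$ has positive density on the lattice of the layer $\xi+\mathcal M$ if for every $\mathbb Z$-basis $(\nu'_0,\dots,\nu'_{n-1})$ of $\mathcal M$ with $\nu'_0=1/b$, $b$ a positive integer, $$\liminf_{k\to\infty}\frac{1}{b(2k)^{n-1}}\,\#\Big\{x=\xi+\sum_{i=0}^{n-1} m_i\nu'_i\in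 A:\ m_i\in\mathbb Z,\ |m_i|\le k \text{ for } i\ne0\Big\}>0 .$$ Suppose that $\|R\|^{n-1}=\|M_\sigma\|$. Then for every integer $T\ge1$ there is $\xi\in\Xi$ such that the set of eventually periodic points of period $T$ in $(\xi+\mathcal M)\cap[0,1)$ has positive density on the lattice of the layer $\xi+\mathcal M$; here, if $a+\rho=1$, it is assumed that some point of $[0,1)$ is eventually periodic of period $T$ (for $a+\rho<1$, in particular for $I=[0,\rho)$, this is automatic). Likewise, for every $T\ge1$ that is the least eventual period of some point of $[0,1)$, there is $\xi\in\Xi$ such that the set of points of $(\xi+\mathcal M)\cap[0,1)$ with least eventual period $T$ has positive density. -/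

import Mathlib

open Set Filter Topology MeasureTheory

noncomputable section

/-- Combinatorial and metric data of an interval exchange transformation of `[0, 1)` with `N`
intervals: the lengths of the intervals, listed from left to right, and the permutation that
gives the position of each interval after the exchange. -/
structure IET (N : ℕ) where
  len : Fin N → ℝ
  perm : Equiv.Perm (Fin N)
  len_pos : ∀ i, 0 < len i
  len_sum : ∑ i, len i = 1

namespace IET

variable {N : ℕ} (E : IET N)

/-- Left endpoint of the `i`-th interval. -/
def left (i : Fin N) : ℝ := ∑ j ∈ Finset.univ.filter (fun j => j < i), E.len j

/-- Left endpoint of the image of the `i`-th interval. -/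
def imageLeft (i : Fin N) : ℝ :=
  ∑ j ∈ Finset.univ.filter (fun j => E.perm j < E.perm i), E.len j

/-- The `i`-th interval `Ω_i`. -/
def atom (i : Fin N) : Set ℝ := Ico (E.left i) (E.left i + E.len i)

/-- The translation `τ_i`. -/
def trans (i : Fin N) : ℝ := E.imageLeft i - E.left i

/-- The map: `x ↦ x + τ_i` on `Ω_i` (and the identity outside `[0, 1)`). -/
def map (x : ℝ) : ℝ := x + ∑ i, (E.atom i).indicator (fun _ => E.trans i) x

/-- The permutation preserves no proper non-empty initial segment. -/
def Irreducible : Prop :=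
  ∀ k : ℕ, 0 < k → k < N → ¬ ∀ i : Fin N, (i : ℕ) < k → (E.perm i : ℕ) < k

/-- Lebesgue measure (which is always invariant) is the only invariant Borel probability measure
on `[0, 1)`. -/
def UniquelyErgodic : Prop :=
  ∀ μ : Measure ℝ, IsProbabilityMeasure μ → μ (Ico (0 : ℝ) 1)ᶜ = 0 →
    MeasurePreserving E.map μ μ → μ = volume.restrict (Ico (0 : ℝ) 1)

/-- The module of the exchange: integral linear combinations of the lengths. -/
def module : Submodule ℤ ℝ := Submodule.span ℤ (Set.range E.len)

/-- The field generated by the lengths. -/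
def field : IntermediateField ℚ ℝ := IntermediateField.adjoin ℚ (Set.range E.len)

/-- The lengths generate an algebraic number field. -/
def IsAlgebraic : Prop := FiniteDimensional ℚ E.field

/-- The degree over `ℚ` of the field generated by the lengths. -/
def degree : ℕ := Module.finrank ℚ E.field

/-- A renormalization: an interval `I = [a, a + ρ) ⊆ [0, 1)` such that the first-return map on `I`
is conjugate to the exchange by the rescaling `x ↦ a + ρ x`, together with the associated
substitution `σ`: the word `σ i` is the common itinerary, through the intervals of the exchange
and until the first return to `I`, of the points of the rescaled `i`-th interval. -/
structure Renormalization where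
  a : ℝ
  ρ : ℝ
  σ : Fin N → List (Fin N)
  a_nonneg : 0 ≤ a
  ρ_pos : 0 < ρ
  ρ_lt_one : ρ < 1
  le_one : a + ρ ≤ 1
  σ_ne_nil : ∀ i, σ i ≠ []
  itinerary : ∀ i, ∀ x ∈ E.atom i, ∀ (j : ℕ) (hj : j < (σ i).length),
    E.map^[j] (a + ρ * x) ∈ E.atom ((σ i)[j])
  not_return : ∀ i, ∀ x ∈ E.atom i, ∀ j : ℕ, 0 < j → j < (σ i).length →
    E.map^[j] (a + ρ * x) ∉ Ico a (a + ρ)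
  first_return : ∀ i, ∀ x ∈ E.atom i,
    E.map^[(σ i).length] (a + ρ * x) = a + ρ * E.map x

namespace Renormalization

variable {E} (r : E.Renormalization)

/-- The incidence matrix `M_σ`: its `(i, j)` entry is the number of letters `i` in `σ j`. -/
def incidence : Matrix (Fin N) (Fin N) ℤ := fun i j => ((r.σ j).count i : ℤ)

/-- A (proper, possibly empty) prefix `μ` of one of the words of the substitution: the index of
the word, and the length of the prefix. -/
def Prefix : Type := Σ i : Fin N, Fin (r.σ i).length

variable {r} in
/-- The exponent `χ(μ)`: the index of the word of which `μ` is a prefix. -/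
def Prefix.exponent (p : r.Prefix) : Fin N := p.1

variable {r} in
/-- The letter `μ₊` that follows the prefix `μ`. -/
def Prefix.next (p : r.Prefix) : Fin N := (r.σ p.1)[p.2]

variable {r} in
/-- The translation `τ_μ`: the sum of the translations of the letters of `μ`. -/
def Prefix.trans (p : r.Prefix) : ℝ := (((r.σ p.1).take p.2).map E.trans).sum

variable {r} in
/-- The rescaling followed by the translation by `τ_μ`. -/
def Prefix.tileMap (p : r.Prefix) (x : ℝ) : ℝ := r.a + r.ρ * x + p.trans

/-- The composition of the tile maps of the first `k` terms of a sequence of prefixes. -/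
def cylinderMap (μ : ℕ → r.Prefix) : ℕ → ℝ → ℝ
  | 0 => id
  | k + 1 => cylinderMap μ k ∘ (μ k).tileMap

/-- The sequence `μ` of prefixes is the Vershik code of `x`: consecutive terms are consistent, and
`x` lies in all the nested tiles that `μ` describes. -/
def IsVershikCode (μ : ℕ → r.Prefix) (x : ℝ) : Prop :=
  (∀ k, (μ k).exponent = (μ (k + 1)).next) ∧
  ∀ k, x ∈ r.cylinderMap μ (k + 1) '' E.atom (μ k).exponent

/-- The Vershik code of `x` is eventually periodic with period `T` (not necessarily the least
one): it is `μ₁ … μ_t (μ_{t+1} … μ_{t+T})^∞` for some `t`. -/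
def EventuallyPeriodic (T : ℕ) (x : ℝ) : Prop :=
  ∃ μ : ℕ → r.Prefix, r.IsVershikCode μ x ∧ ∃ t : ℕ, ∀ k, t ≤ k → μ (k + T) = μ k

/-- `T` is the least eventual period of the Vershik code of `x`. -/
def EventuallyPeriodicLeast (T : ℕ) (x : ℝ) : Prop :=
  r.EventuallyPeriodic T x ∧ ∀ T' : ℕ, 0 < T' → T' < T → ¬ r.EventuallyPeriodic T' x

open Classical in
/-- The integral matrix `R` of the multiplication by `ρ` on the module, in the basis `ν`.
(The module is stable under this multiplication, so the default value is never used.) -/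
def scalingMatrix {ι : Type} (ν : Module.Basis ι ℤ E.module) : Matrix ι ι ℤ :=
  fun i j => if h : r.ρ * (ν j : ℝ) ∈ E.module then ν.repr ⟨r.ρ * (ν j : ℝ), h⟩ i else 0

end Renormalization

/-- The norm of an integral matrix that is used here: its spectral radius, the largest modulus of
a complex eigenvalue. -/
def specNorm {ι : Type} [Fintype ι] [DecidableEq ι] (A : Matrix ι ι ℤ) : ENNReal :=
  spectralRadius ℂ (A.map (Int.cast : ℤ → ℂ))

/-- The representatives `Ξ` of the layers: combinations of the basis with rational coefficients
in `[0, 1)`. -/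
def layerReps {ι : Type} [Fintype ι] (ν : Module.Basis ι ℤ E.module) : Set ℝ :=
  {ξ | ∃ q : ι → ℚ, (∀ k, 0 ≤ q k ∧ q k < 1) ∧ ξ = ∑ k, (q k : ℝ) * (ν k : ℝ)}

/-- The basis `ν` of the module is adapted to its quotient by `ℤ`: the basis element of index `o`
is `1 / b`. It then generates the group of rational numbers in the module, and the other
coordinates together with the coordinate of index `o` modulo `b` identify the quotient with
`(ℤ / b) ⊕ ℤ ^ (n - 1)`. -/
def IsReducedBasis {ι : Type} (ν : Module.Basis ι ℤ E.module) (o : ι) (b : ℕ) : Prop :=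
  0 < b ∧ (ν o : ℝ) = 1 / (b : ℝ)

/-- The number of points of `A` in the restriction to `[0, 1)` of the layer `ξ + module` whose
lattice coordinates, apart from the one of index `o`, are at most `k` in absolute value. -/
def boxCount {ι : Type} (ν : Module.Basis ι ℤ E.module) (o : ι) (ξ : ℝ) (A : Set ℝ) (k : ℕ) : ℕ :=
  Set.ncard {x : ℝ | x ∈ A ∧ x ∈ Ico (0 : ℝ) 1 ∧
    ∃ m : E.module, x = ξ + (m : ℝ) ∧ ∀ i, i ≠ o → |ν.repr m i| ≤ (k : ℤ)}

/-- `A` has positive (lower) density on the reduced lattice of the layer `ξ + module`, in the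
coordinates of every reduced basis:
`liminf_{k → ∞} #{points of A in the box of size k} / (b (2k)^(n-1)) > 0`. -/
def HasPositiveDensity (ι : Type) (ξ : ℝ) (A : Set ℝ) : Prop :=
  ∀ (ν : Module.Basis ι ℤ E.module) (o : ι) (b : ℕ), E.IsReducedBasis ν o b →
    ∃ c : ℝ, 0 < c ∧ ∀ᶠ k : ℕ in atTop,
      c ≤ (E.boxCount ν o ξ A k : ℝ) / ((b : ℝ) * (2 * (k : ℝ)) ^ (E.degree - 1))

end IET

end

/-!
The desubstitution map `D` (`IET.Renormalization.desub`) sends a point of the tile `f_μ(Ω_χ(μ))` to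
its preimage under `f_μ`. Tiles partition `[0, 1)` (`exists_tile`, `tile_unique`), the Vershik code
of `x` lists the tiles of `x, D x, D² x, …`, and its eventual periodicity is eventual periodicity
of the orbit of `x` under `D` (`eventuallyPeriodic_iff`). So the set in question contains, with a
point `y = D^T y`, all the preimages of `y` under the iterates of `D`. Only those of order `T q` are
needed, and two growth rates are compared.

*Number.* A point of `Ω_j` has `h_k(j) = |σ^k(j)|` preimages of order `k`, where
`∑ h_k(j) |Ω_j| = ρ^{-k}`, because the lengths are an eigenvector of `M_σ` for `ρ⁻¹`. Each `h_k(j)`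
separately is at least `c ρ^{-k}` (`exists_le_height`), because all atoms meet all towers of some
level (`exists_level_meets_atoms`). This follows from uniform minimality (`exists_visit_bound`) and
the absence of periodic points, both of which come from unique ergodicity: a finite union of
intervals that is mapped into itself carries an invariant measure, hence is all of `[0, 1)`.

*Coordinates.* The module is stable under multiplication by `ρ` (`mul_mem_module`) and contains
`a` (`a_mem_module`). Thus `y` is a rational combination of the basis, and its preimages of order
`T q` all lie in the layer of `y`. Their conjugates are `O(Λ^{Tq})` with `Λ = ‖R‖ > 1`
(`exists_norm_embedding_le`), since the conjugates of `ρ` are eigenvalues of `R`; so are their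
coordinates, which are traces `Tr (β x)` (`exists_abs_repr_le`).

A box of size about `Λ^{Tq}` therefore contains at least `c ρ^{-Tq}` of these points. Since
`ρ⁻¹ = ‖M_σ‖ = Λ^{n-1}` (`specNorm_incidence`), this is a positive proportion of its volume.
-/

namespace IET

variable {N : ℕ} (E : IET N)

/-! ### The exchange as an injection of the unit interval -/

lemma sum_filter_add_le (e : Fin N → Fin N) {i j : Fin N} (h : e i < e j) :
    ∑ k ∈ Finset.univ.filter (fun k => e k < e i), E.len k + E.len i ≤
      ∑ k ∈ Finset.univ.filter (fun k => e k < e j), E.len k := by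
  rw [add_comm, ← Finset.sum_insert (by simp)]
  refine Finset.sum_le_sum_of_subset_of_nonneg ?_ fun k _ _ => (E.len_pos k).le
  intro k hk
  simp only [Finset.mem_insert, Finset.mem_filter, Finset.mem_univ, true_and] at hk ⊢
  rcases hk with rfl | hk
  · exact h
  · exact hk.trans h

lemma sum_filter_add_le_one (e : Fin N → Fin N) (i : Fin N) :
    ∑ k ∈ Finset.univ.filter (fun k => e k < e i), E.len k + E.len i ≤ 1 := by
  rw [add_comm, ← Finset.sum_insert (by simp), ← E.len_sum]
  exact Finset.sum_le_sum_of_subset_of_nonneg (Finset.subset_univ _)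
    fun k _ _ => (E.len_pos k).le

lemma left_add_le {i j : Fin N} (h : i < j) : E.left i + E.len i ≤ E.left j :=
  E.sum_filter_add_le id h

lemma left_add_le_one (i : Fin N) : E.left i + E.len i ≤ 1 :=
  E.sum_filter_add_le_one id i

lemma left_nonneg (i : Fin N) : 0 ≤ E.left i :=
  Finset.sum_nonneg fun k _ => (E.len_pos k).le

lemma imageLeft_add_le {i j : Fin N} (h : E.perm i < E.perm j) :
    E.imageLeft i + E.len i ≤ E.imageLeft j :=
  E.sum_filter_add_le E.perm h

lemma imageLeft_add_le_one (i : Fin N) : E.imageLeft i + E.len i ≤ 1 :=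
  E.sum_filter_add_le_one E.perm i

lemma imageLeft_nonneg (i : Fin N) : 0 ≤ E.imageLeft i :=
  Finset.sum_nonneg fun k _ => (E.len_pos k).le

lemma atom_subset (i : Fin N) : E.atom i ⊆ Ico 0 1 := fun _ hx =>
  ⟨(E.left_nonneg i).trans hx.1, hx.2.trans_le (E.left_add_le_one i)⟩

lemma left_mem_atom (i : Fin N) : E.left i ∈ E.atom i :=
  ⟨le_rfl, lt_add_of_pos_right _ (E.len_pos i)⟩

lemma atom_unique {i j : Fin N} {x : ℝ} (hi : x ∈ E.atom i) (hj : x ∈ E.atom j) : i = j := by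
  rcases lt_trichotomy i j with h | h | h
  · exact absurd (hi.2.trans_le ((E.left_add_le h).trans hj.1)) (lt_irrefl _)
  · exact h
  · exact absurd (hj.2.trans_le ((E.left_add_le h).trans hi.1)) (lt_irrefl _)

lemma exists_mem_atom {x : ℝ} (hx : x ∈ Ico (0 : ℝ) 1) : ∃ i, x ∈ E.atom i := by
  have hN : 0 < N := by
    rcases Nat.eq_zero_or_pos N with rfl | h
    · have := E.len_sum
      simp at this
    · exact h
  have h0 : E.left ⟨0, hN⟩ = 0 := by
    rw [left, Finset.filter_false_of_mem, Finset.sum_empty]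
    intro j _ hj
    simp [Fin.lt_def] at hj
  obtain ⟨i, hi, hmax⟩ := Finset.exists_max_image (Finset.univ.filter fun i => E.left i ≤ x) id
    ⟨⟨0, hN⟩, by simp [h0, hx.1]⟩
  simp only [Finset.mem_filter, Finset.mem_univ, true_and, id] at hi hmax
  refine ⟨i, hi, ?_⟩
  by_contra hcon
  push Not at hcon
  have hle : E.left i + E.len i = ∑ k ∈ Finset.univ.filter (fun k => k ≤ i), E.len k := by
    rw [left, add_comm, ← Finset.sum_insert (by simp)]
    congr 1
    ext k
    simp [le_iff_eq_or_lt]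
  by_cases hs : (i : ℕ) + 1 < N
  · have h1 : E.left ⟨i + 1, hs⟩ = E.left i + E.len i := by
      rw [hle, left]
      congr 1
      ext k
      simp only [Finset.mem_filter, Finset.mem_univ, true_and]
      rw [Fin.lt_def, Fin.le_def]
      exact Nat.lt_succ_iff
    have h2 := hmax ⟨i + 1, hs⟩ (h1.trans_le hcon)
    simp [Fin.le_def] at h2
  · have h1 : E.left i + E.len i = 1 := by
      rw [hle, ← E.len_sum, Finset.filter_true_of_mem]
      intro k _
      rw [Fin.le_def]
      omega
    linarith [hx.2]

lemma map_of_mem_atom {i : Fin N} {x : ℝ} (hx : x ∈ E.atom i) : E.map x = x + E.trans i := by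
  rw [map, Finset.sum_eq_single i]
  · rw [indicator_of_mem hx]
  · intro j _ hj
    exact indicator_of_notMem (fun h => hj (E.atom_unique h hx)) _
  · simp

lemma map_mem {x : ℝ} (hx : x ∈ Ico (0 : ℝ) 1) : E.map x ∈ Ico (0 : ℝ) 1 := by
  obtain ⟨i, hi⟩ := E.exists_mem_atom hx
  rw [E.map_of_mem_atom hi, trans]
  have h1 := E.imageLeft_nonneg i
  have h2 := E.imageLeft_add_le_one i
  constructor <;> linarith [hi.1, hi.2]

lemma iterate_map_mem {x : ℝ} (hx : x ∈ Ico (0 : ℝ) 1) (n : ℕ) :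
    E.map^[n] x ∈ Ico (0 : ℝ) 1 := by
  induction n with
  | zero => exact hx
  | succ n ih => rw [Function.iterate_succ_apply']; exact E.map_mem ih

lemma map_injOn : InjOn E.map (Ico (0 : ℝ) 1) := by
  intro x hx y hy h
  obtain ⟨i, hi⟩ := E.exists_mem_atom hx
  obtain ⟨j, hj⟩ := E.exists_mem_atom hy
  rw [E.map_of_mem_atom hi, E.map_of_mem_atom hj, trans, trans] at h
  have h1 := hi.1
  have h2 := hi.2
  have h3 := hj.1
  have h4 := hj.2
  rcases lt_trichotomy (E.perm i) (E.perm j) with hp | hp | hp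
  · have := E.imageLeft_add_le hp
    linarith
  · obtain rfl := E.perm.injective hp
    linarith
  · have := E.imageLeft_add_le hp
    linarith

lemma iterate_map_injOn (n : ℕ) : InjOn E.map^[n] (Ico (0 : ℝ) 1) :=
  E.map_injOn.iterate (fun _ hx => E.map_mem hx) n

lemma measurableSet_atom (i : Fin N) : MeasurableSet (E.atom i) := measurableSet_Ico

lemma measurable_map : Measurable E.map :=
  measurable_id.add (Finset.measurable_sum _ fun i _ =>
    measurable_const.indicator (E.measurableSet_atom i))

lemma image_map_eq_iUnion {W : Set ℝ} (hW : W ⊆ Ico 0 1) :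
    E.map '' W = ⋃ i, (fun x => x + E.trans i) '' (W ∩ E.atom i) := by
  ext y
  simp only [mem_image, mem_iUnion, mem_inter_iff]
  constructor
  · rintro ⟨x, hx, rfl⟩
    obtain ⟨i, hi⟩ := E.exists_mem_atom (hW hx)
    exact ⟨i, x, ⟨hx, hi⟩, (E.map_of_mem_atom hi).symm⟩
  · rintro ⟨i, x, ⟨hx, hi⟩, rfl⟩
    exact ⟨x, hx, E.map_of_mem_atom hi⟩

lemma measurableSet_image_map {W : Set ℝ} (hW : W ⊆ Ico 0 1) (hm : MeasurableSet W) :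
    MeasurableSet (E.map '' W) :=
  hm.image_of_measurable_injOn E.measurable_map (E.map_injOn.mono hW)

/-- The exchange preserves the measure of sets: it is an injective piecewise translation. -/
lemma volume_image_map {W : Set ℝ} (hW : W ⊆ Ico 0 1) (hm : MeasurableSet W) :
    volume (E.map '' W) = volume W := by
  have hU : W = ⋃ i, W ∩ E.atom i := by
    rw [← inter_iUnion, eq_comm, inter_eq_left]
    intro x hx
    exact mem_iUnion.2 (E.exists_mem_atom (hW hx))
  have hmi : ∀ i, MeasurableSet (W ∩ E.atom i) := fun i => hm.inter (E.measurableSet_atom i)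
  have himg : ∀ i, (fun x => x + E.trans i) '' (W ∩ E.atom i) = E.map '' (W ∩ E.atom i) :=
    fun i => image_congr fun x hx => (E.map_of_mem_atom hx.2).symm
  have hd : Pairwise (Function.onFun Disjoint fun i => W ∩ E.atom i) := fun i j hij =>
    disjoint_left.2 fun x h1 h2 => hij (E.atom_unique h1.2 h2.2)
  rw [E.image_map_eq_iUnion hW]
  simp only [himg]
  rw [measure_iUnion _ fun i => E.measurableSet_image_map (inter_subset_left.trans hW) (hmi i)]
  · conv_rhs => rw [hU, measure_iUnion hd hmi]
    congr 1
    ext i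
    rw [← himg, image_add_right, measure_preimage_add_right]
  · intro i j hij
    refine disjoint_left.2 ?_
    rintro _ ⟨x, hx, rfl⟩ ⟨y, hy, hxy⟩
    have := E.map_injOn (hW hy.1) (hW hx.1) hxy
    subst this
    exact hij (E.atom_unique hx.2 hy.2)

end IET

/-! ### Finite unions of half-open intervals -/

/-- Finite unions of half-open intervals `[a, b)` of the real line. -/
inductive IsIcoUnion : Set ℝ → Prop
  | empty : IsIcoUnion ∅
  | union (a b : ℝ) {A : Set ℝ} : IsIcoUnion A → IsIcoUnion (Ico a b ∪ A)

namespace IsIcoUnion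

lemma ico (a b : ℝ) : IsIcoUnion (Ico a b) := by
  simpa using IsIcoUnion.union a b .empty

lemma sup {A B : Set ℝ} (hA : IsIcoUnion A) (hB : IsIcoUnion B) : IsIcoUnion (A ∪ B) := by
  induction hA with
  | empty => simpa using hB
  | union a b _ ih => rw [union_assoc]; exact .union a b ih

lemma biUnion {ι : Type*} (s : Finset ι) {A : ι → Set ℝ} (h : ∀ i ∈ s, IsIcoUnion (A i)) :
    IsIcoUnion (⋃ i ∈ s, A i) := by
  classical
  induction s using Finset.induction_on with
  | empty => simpa using IsIcoUnion.empty
  | insert i s _ ih =>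
    rw [Finset.set_biUnion_insert]
    exact (h i (Finset.mem_insert_self i s)).sup (ih fun j hj => h j (Finset.mem_insert_of_mem hj))

lemma iUnion {ι : Type*} [Fintype ι] {A : ι → Set ℝ} (h : ∀ i, IsIcoUnion (A i)) :
    IsIcoUnion (⋃ i, A i) := by
  simpa using biUnion Finset.univ fun i _ => h i

lemma inter_ico {A : Set ℝ} (hA : IsIcoUnion A) (c d : ℝ) : IsIcoUnion (A ∩ Ico c d) := by
  induction hA with
  | empty => simpa using IsIcoUnion.empty
  | union a b _ ih => rw [union_inter_distrib_right, Ico_inter_Ico]; exact .union _ _ ih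

lemma diff_ico {A : Set ℝ} (hA : IsIcoUnion A) (c d : ℝ) : IsIcoUnion (A \ Ico c d) := by
  induction hA with
  | empty => simpa using IsIcoUnion.empty
  | union a b _ ih =>
    rw [union_sdiff_distrib]
    have : Ico a b \ Ico c d = Ico a (min b c) ∪ Ico (max a d) b := by
      ext x
      simp only [Set.mem_sdiff, mem_Ico, mem_union, lt_min_iff, max_le_iff, not_and_or, not_le, not_lt]
      tauto
    rw [this]
    exact ((ico _ _).sup (ico _ _)).sup ih

lemma translate {A : Set ℝ} (hA : IsIcoUnion A) (t : ℝ) :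
    IsIcoUnion ((fun x => x + t) '' A) := by
  induction hA with
  | empty => simpa using IsIcoUnion.empty
  | union a b _ ih => rw [image_union, image_add_const_Ico]; exact .union _ _ ih

lemma measurableSet {A : Set ℝ} (hA : IsIcoUnion A) : MeasurableSet A := by
  induction hA with
  | empty => exact .empty
  | union a b _ ih => exact measurableSet_Ico.union ih

lemma exists_length {A : Set ℝ} (hA : IsIcoUnion A) :
    ∃ δ > 0, ∀ x ∈ A, ∃ p q, x ∈ Ico p q ∧ δ ≤ q - p ∧ Ico p q ⊆ A := by
  induction hA with
  | empty => exact ⟨1, one_pos, fun x hx => hx.elim⟩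
  | union a b _ ih =>
    obtain ⟨δ, hδ, h⟩ := ih
    rcases lt_or_ge a b with hab | hab
    · refine ⟨min δ (b - a), lt_min hδ (sub_pos.2 hab), ?_⟩
      rintro x (hx | hx)
      · exact ⟨a, b, hx, min_le_right _ _, subset_union_left⟩
      · obtain ⟨p, q, h1, h2, h3⟩ := h x hx
        exact ⟨p, q, h1, (min_le_left _ _).trans h2, h3.trans subset_union_right⟩
    · rw [Ico_eq_empty (not_lt.2 hab), empty_union]
      exact ⟨δ, hδ, h⟩

lemma exists_disjoint_ico {A : Set ℝ} (hA : IsIcoUnion A) {x : ℝ} (hx : x ∉ A) :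
    ∃ y > x, Disjoint (Ico x y) A := by
  induction hA with
  | empty => exact ⟨x + 1, by simp, disjoint_empty _⟩
  | union a b _ ih =>
    rw [mem_union, not_or] at hx
    obtain ⟨y, hy, h⟩ := ih hx.2
    rcases lt_or_ge x a with hxa | hxa
    · refine ⟨min y a, lt_min hy hxa, disjoint_union_right.2 ⟨?_, h.mono_left ?_⟩⟩
      · exact disjoint_left.2 fun z hz hz' =>
          absurd (hz.2.trans_le (min_le_right _ _)) (not_lt.2 hz'.1)
      · exact Ico_subset_Ico_right (min_le_left _ _)
    · refine ⟨y, hy, disjoint_union_right.2 ⟨disjoint_left.2 fun z hz hz' => ?_, h⟩⟩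
      exact hx.1 ⟨hxa, hz.1.trans_lt hz'.2⟩

end IsIcoUnion

namespace IET

variable {N : ℕ} (E : IET N)

lemma isIcoUnion_image_map {W : Set ℝ} (hW : W ⊆ Ico 0 1) (h : IsIcoUnion W) :
    IsIcoUnion (E.map '' W) := by
  rw [E.image_map_eq_iUnion hW]
  exact .iUnion fun i => (h.inter_ico _ _).translate _

/-! ### Consequences of unique ergodicity -/

lemma measurePreserving_restrict {W : Set ℝ} (hW : W ⊆ Ico 0 1) (hm : MeasurableSet W)
    (hE : MapsTo E.map W W) :
    MeasurePreserving E.map (volume.restrict W) (volume.restrict W) := by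
  refine ⟨E.measurable_map, Measure.ext fun A hA => ?_⟩
  have hpre : MeasurableSet (E.map ⁻¹' A) := E.measurable_map hA
  rw [Measure.map_apply E.measurable_map hA, Measure.restrict_apply hA,
    Measure.restrict_apply hpre,
    ← E.volume_image_map (inter_subset_right.trans hW) (hpre.inter hm), inter_comm,
    image_inter_preimage, inter_comm]
  have hsub : E.map '' W ⊆ W := hE.image_subset
  have hfin : volume W ≠ ⊤ := ((measure_mono hW).trans_lt (by simp)).ne
  have hnull : volume (W \ E.map '' W) = 0 := by
    rw [measure_sdiff hsub (E.measurableSet_image_map hW hm).nullMeasurableSet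
      (by rw [E.volume_image_map hW hm]; exact hfin), E.volume_image_map hW hm, tsub_self]
  refine le_antisymm (measure_mono (inter_subset_inter_right _ hsub)) ?_
  calc volume (A ∩ W) ≤ volume (A ∩ E.map '' W ∪ W \ E.map '' W) := by
        refine measure_mono fun x hx => ?_
        by_cases h : x ∈ E.map '' W
        · exact Or.inl ⟨hx.1, h⟩
        · exact Or.inr ⟨hx.2, h⟩
    _ ≤ _ := (measure_union_le _ _).trans (by rw [hnull, add_zero])

variable {E}

/-- The normalized Lebesgue measure on a forward invariant set is invariant; hence such a set has
full measure, and it is everything when it is a finite union of half-open intervals. -/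
lemma UniquelyErgodic.eq_of_mapsTo (hue : E.UniquelyErgodic) {W : Set ℝ} (hW : W ⊆ Ico 0 1)
    (hI : IsIcoUnion W) (hne : W.Nonempty) (hE : MapsTo E.map W W) : W = Ico 0 1 := by
  have hm := hI.measurableSet
  have hfin : volume W ≠ ⊤ := ((measure_mono hW).trans_lt (by simp)).ne
  have hpos : volume W ≠ 0 := by
    obtain ⟨x, hx⟩ := hne
    obtain ⟨δ, hδ, h⟩ := hI.exists_length
    obtain ⟨p, q, -, h2, h3⟩ := h x hx
    refine ((?_ : 0 < volume (Ico p q)).trans_le (measure_mono h3)).ne'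
    rw [Real.volume_Ico, ENNReal.ofReal_pos]
    linarith
  have key := hue ((volume W)⁻¹ • volume.restrict W)
    ⟨by simp [ENNReal.inv_mul_cancel hpos hfin]⟩
    (by simp only [Measure.smul_apply, smul_eq_mul, mul_eq_zero]
        right
        rw [Measure.restrict_apply measurableSet_Ico.compl]
        refine measure_mono_null (t := ∅) ?_ measure_empty
        exact fun x hx => hx.1 (hW hx.2))
    ((E.measurePreserving_restrict hW hm hE).smul_measure _)
  have hz : volume (Ico 0 1 \ W) = 0 := by
    have h1 := congrArg (fun μ : Measure ℝ => μ (Ico 0 1 \ W)) key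
    simp only [Measure.smul_apply, smul_eq_mul] at h1
    rw [Measure.restrict_apply (measurableSet_Ico.diff hm),
      Measure.restrict_apply (measurableSet_Ico.diff hm), inter_eq_left.2 sdiff_subset] at h1
    rw [← h1, show (Ico 0 1 \ W) ∩ W = ∅ from by simp]
    simp
  refine hW.antisymm fun x hx => ?_
  by_contra hxW
  obtain ⟨y, hy, hd⟩ := hI.exists_disjoint_ico hxW
  have hsub : Ico x (min y 1) ⊆ Ico 0 1 \ W := fun z hz =>
    ⟨⟨hx.1.trans hz.1, hz.2.trans_le (min_le_right _ _)⟩,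
      disjoint_left.1 hd ⟨hz.1, hz.2.trans_le (min_le_left _ _)⟩⟩
  have h2 := measure_mono_null hsub hz
  rw [Real.volume_Ico, ENNReal.ofReal_eq_zero] at h2
  have := lt_min hy hx.2
  linarith

/-- There are no periodic points: the orbit of such a point would carry an invariant atomic
measure. -/
lemma UniquelyErgodic.iterate_map_ne (hue : E.UniquelyErgodic) {x : ℝ} (hx : x ∈ Ico (0 : ℝ) 1)
    {l : ℕ} (hl : 0 < l) : E.map^[l] x ≠ x := by
  intro hper
  have hl0 : (l : ENNReal) ≠ 0 := by exact_mod_cast hl.ne'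
  have hlt : (l : ENNReal) ≠ ⊤ := ENNReal.natCast_ne_top l
  set ν : Measure ℝ := ∑ m ∈ Finset.range l, Measure.dirac (E.map^[m] x) with hν
  have hν_apply : ∀ A, MeasurableSet A → ν A = ∑ m ∈ Finset.range l,
      A.indicator (1 : ℝ → ENNReal) (E.map^[m] x) := by
    intro A hA
    rw [hν, Measure.finsetSum_apply]
    exact Finset.sum_congr rfl fun m _ => Measure.dirac_apply' _ hA
  have hinv : MeasurePreserving E.map ν ν := by
    refine ⟨E.measurable_map, Measure.ext fun A hA => ?_⟩
    rw [Measure.map_apply E.measurable_map hA, hν_apply _ hA, hν_apply _ (E.measurable_map hA)]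
    have h1 : ∀ m, (E.map ⁻¹' A).indicator (1 : ℝ → ENNReal) (E.map^[m] x) =
        A.indicator (1 : ℝ → ENNReal) (E.map^[m + 1] x) := by
      intro m
      rw [Function.iterate_succ_apply']
      rfl
    simp only [h1]
    obtain ⟨k, rfl⟩ : ∃ k, l = k + 1 := ⟨l - 1, by omega⟩
    rw [Finset.sum_range_succ, hper, Finset.sum_range_succ' _ k]
    rfl
  have key := hue ((l : ENNReal)⁻¹ • ν)
    ⟨by
      rw [Measure.smul_apply, hν_apply _ .univ]
      simp [ENNReal.inv_mul_cancel hl0 hlt]⟩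
    (by
      rw [Measure.smul_apply, hν_apply _ measurableSet_Ico.compl, Finset.sum_eq_zero, smul_zero]
      intro m _
      exact indicator_of_notMem (notMem_compl_iff.2 (E.iterate_map_mem hx m)) _)
    (hinv.smul_measure _)
  have h1 := congrArg (fun μ : Measure ℝ => μ {x}) key
  have h2 : volume.restrict (Ico (0 : ℝ) 1) {x} = 0 :=
    le_antisymm ((Measure.restrict_apply_le _ _).trans (by simp)) zero_le
  simp only [Measure.smul_apply, h2, smul_eq_mul, mul_eq_zero, ENNReal.inv_eq_zero, hlt,
    false_or] at h1
  rw [hν_apply _ (measurableSet_singleton x), Finset.sum_eq_zero_iff] at h1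
  simpa using h1 0 (Finset.mem_range.2 hl)

end IET

namespace IET

variable {N : ℕ} (E : IET N)

/-! ### Visits to an interval occur within bounded time -/

/-- The points of the `m`-th image of `V` that do not belong to an earlier image, constructed
recursively: the points of `V` are discarded at each step. -/
def fresh (V : Set ℝ) : ℕ → Set ℝ
  | 0 => V
  | m + 1 => E.map '' fresh V m \ V

variable {E}

lemma fresh_subset {V : Set ℝ} (hV : V ⊆ Ico 0 1) (m : ℕ) : E.fresh V m ⊆ Ico 0 1 := by
  induction m with
  | zero => exact hV
  | succ m ih =>
    rintro _ ⟨⟨x, hx, rfl⟩, -⟩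
    exact E.map_mem (ih hx)

lemma exists_of_mem_fresh {V : Set ℝ} {m : ℕ} {x : ℝ} (hx : x ∈ E.fresh V m) :
    ∃ y ∈ V, E.map^[m] y = x := by
  induction m generalizing x with
  | zero => exact ⟨x, hx, rfl⟩
  | succ m ih =>
    obtain ⟨⟨z, hz, rfl⟩, -⟩ := hx
    obtain ⟨y, hy, rfl⟩ := ih hz
    exact ⟨y, hy, Function.iterate_succ_apply' _ _ _⟩

lemma disjoint_image_map {A B : Set ℝ} (hA : A ⊆ Ico 0 1) (hB : B ⊆ Ico 0 1)
    (h : Disjoint A B) : Disjoint (E.map '' A) (E.map '' B) := by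
  refine disjoint_left.2 ?_
  rintro _ ⟨x, hx, rfl⟩ ⟨y, hy, hxy⟩
  rw [E.map_injOn (hB hy) (hA hx) hxy] at hy
  exact disjoint_left.1 h hx hy

lemma pairwise_disjoint_fresh {V : Set ℝ} (hV : V ⊆ Ico 0 1) :
    Pairwise (Function.onFun Disjoint (E.fresh V)) := by
  have key : ∀ m n, Disjoint (E.fresh V m) (E.fresh V (m + n + 1)) := by
    intro m n
    induction m with
    | zero => exact disjoint_sdiff_right
    | succ m ih =>
      rw [show m + 1 + n + 1 = (m + n + 1) + 1 by ring]
      exact (disjoint_image_map (fresh_subset hV m) (fresh_subset hV _) ih).mono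
        sdiff_subset sdiff_subset
  intro m n hmn
  rcases lt_or_gt_of_ne hmn with h | h
  · obtain ⟨k, rfl⟩ := Nat.exists_eq_add_of_lt h
    exact key m k
  · obtain ⟨k, rfl⟩ := Nat.exists_eq_add_of_lt h
    exact (key n k).symm

lemma eventually_notMem_of_pairwise_disjoint {s : ℕ → Set ℝ}
    (hs : Pairwise (Function.onFun Disjoint s)) (d : ℝ) : ∀ᶠ m in atTop, d ∉ s m := by
  by_cases h : ∃ m, d ∈ s m
  · obtain ⟨m, hm⟩ := h
    filter_upwards [eventually_gt_atTop m] with n hn hd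
    exact disjoint_left.1 (hs hn.ne) hm hd
  · push Not at h
    exact .of_forall h

/-- If none of the points at which the exchange or the removal of `[u, v)` can cut an interval
is met, a lower bound for the lengths of the components is inherited by the next fresh set. -/
lemma fresh_succ_length {u v : ℝ} (hV : Ico u v ⊆ Ico 0 1) {m : ℕ} {δ : ℝ}
    (hleft : ∀ i, E.left i ∉ E.fresh (Ico u v) m)
    (hu : u ∉ E.map '' E.fresh (Ico u v) m) (hv : v ∉ E.map '' E.fresh (Ico u v) m)
    (h : ∀ x ∈ E.fresh (Ico u v) m, ∃ p q, x ∈ Ico p q ∧ δ ≤ q - p ∧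
      Ico p q ⊆ E.fresh (Ico u v) m) :
    ∀ x ∈ E.fresh (Ico u v) (m + 1), ∃ p q, x ∈ Ico p q ∧ δ ≤ q - p ∧
      Ico p q ⊆ E.fresh (Ico u v) (m + 1) := by
  rintro _ ⟨⟨x, hx, rfl⟩, hxV⟩
  obtain ⟨p, q, hxpq, hδ, hsub⟩ := h x hx
  obtain ⟨i, hi⟩ := E.exists_mem_atom (fresh_subset hV m hx)
  have hatom : Ico p q ⊆ E.atom i := by
    intro y hy
    obtain ⟨j, hj⟩ := E.exists_mem_atom (fresh_subset hV m (hsub hy))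
    rcases lt_trichotomy i j with hij | rfl | hij
    · have hlt : x < E.left j := hi.2.trans_le (E.left_add_le hij)
      exact absurd (hsub ⟨hxpq.1.trans hlt.le, hj.1.trans_lt hy.2⟩) (hleft j)
    · exact hj
    · have hlt : y < E.left i := hj.2.trans_le (E.left_add_le hij)
      exact absurd (hsub ⟨hy.1.trans hlt.le, hi.1.trans_lt hxpq.2⟩) (hleft i)
  have himg : Ico (p + E.trans i) (q + E.trans i) ⊆ E.map '' E.fresh (Ico u v) m := by
    intro y hy
    have hy' : y - E.trans i ∈ Ico p q := ⟨by linarith [hy.1], by linarith [hy.2]⟩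
    exact ⟨_, hsub hy', by rw [E.map_of_mem_atom (hatom hy')]; ring⟩
  rw [E.map_of_mem_atom hi] at hxV ⊢
  have hxI : x + E.trans i ∈ Ico (p + E.trans i) (q + E.trans i) :=
    ⟨by linarith [hxpq.1], by linarith [hxpq.2]⟩
  refine ⟨_, _, hxI, by linarith, fun y hy => ⟨himg hy, fun hyV => ?_⟩⟩
  rcases lt_or_ge (x + E.trans i) u with hxu | hxu
  · exact hu (himg ⟨hxI.1.trans hxu.le, hyV.1.trans_lt hy.2⟩)
  · have hxv : v ≤ x + E.trans i := not_lt.1 fun hlt => hxV ⟨hxu, hlt⟩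
    exact hv (himg ⟨hy.1.trans hyV.2.le, hxv.trans_lt hxI.2⟩)

lemma exists_fresh_eq_empty {u v : ℝ} (hV : Ico u v ⊆ Ico 0 1) :
    ∃ n, E.fresh (Ico u v) n = ∅ := by
  by_contra! hne
  have hdisj := pairwise_disjoint_fresh (E := E) hV
  have hIco : ∀ m, IsIcoUnion (E.fresh (Ico u v) m) := by
    intro m
    induction m with
    | zero => exact .ico u v
    | succ m ih => exact (E.isIcoUnion_image_map (fresh_subset hV m) ih).diff_ico u v
  have hdisj' : Pairwise (Function.onFun Disjoint fun m => E.map '' E.fresh (Ico u v) m) :=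
    fun m n hmn => disjoint_image_map (fresh_subset hV m) (fresh_subset hV n) (hdisj hmn)
  have hev : ∀ᶠ m in atTop, (∀ i, E.left i ∉ E.fresh (Ico u v) m) ∧
      u ∉ E.map '' E.fresh (Ico u v) m ∧ v ∉ E.map '' E.fresh (Ico u v) m :=
    (eventually_all.2 fun i => eventually_notMem_of_pairwise_disjoint hdisj (E.left i)).and
      ((eventually_notMem_of_pairwise_disjoint hdisj' u).and
        (eventually_notMem_of_pairwise_disjoint hdisj' v))
  obtain ⟨M, hM⟩ := eventually_atTop.1 hev
  obtain ⟨δ, hδ, hlen⟩ := (hIco M).exists_length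
  have hlen' : ∀ m, M ≤ m → ∀ x ∈ E.fresh (Ico u v) m, ∃ p q, x ∈ Ico p q ∧ δ ≤ q - p ∧
      Ico p q ⊆ E.fresh (Ico u v) m := by
    intro m hm
    induction m, hm using Nat.le_induction with
    | base => exact hlen
    | succ m hm ih =>
      obtain ⟨h1, h2, h3⟩ := hM m hm
      exact fresh_succ_length hV h1 h2 h3 ih
  -- infinitely many disjoint sets of measure at least `δ` do not fit into `[0, 1)`
  have hfin := Measure.finite_const_le_meas_of_disjoint_iUnion volume
    (ENNReal.ofReal_pos.2 hδ) (fun m => (hIco m).measurableSet) hdisj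
    ((measure_mono (iUnion_subset fun m => fresh_subset hV m)).trans_lt (by simp)).ne
  refine infinite_of_forall_exists_gt (fun n => ?_) hfin
  obtain ⟨x, hx⟩ := hne (max M (n + 1))
  obtain ⟨p, q, -, h2, h3⟩ := hlen' _ (le_max_left _ _) x hx
  refine ⟨_, ?_, (Nat.lt_succ_self n).trans_le (le_max_right M (n + 1))⟩
  calc ENNReal.ofReal δ ≤ volume (Ico p q) := by
        rw [Real.volume_Ico]
        exact ENNReal.ofReal_le_ofReal h2
    _ ≤ _ := measure_mono h3

/-- Uniform minimality: every orbit visits a given interval within a uniformly bounded time.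
Finitely many of the disjoint fresh sets cover a forward invariant finite union of intervals,
which is everything by unique ergodicity. -/
lemma UniquelyErgodic.exists_visit_bound (hue : E.UniquelyErgodic) {u v : ℝ} (huv : u < v)
    (hV : Ico u v ⊆ Ico 0 1) :
    ∃ L : ℕ, ∀ x ∈ Ico (0 : ℝ) 1, ∃ m, m ≤ L ∧ E.map^[m] x ∈ Ico u v := by
  obtain ⟨n, hn⟩ := exists_fresh_eq_empty (E := E) hV
  have hn0 : 0 < n := by
    rcases Nat.eq_zero_or_pos n with rfl | h
    · exact absurd hn (nonempty_Ico.2 huv).ne_empty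
    · exact h
  have hIco : ∀ m, IsIcoUnion (E.fresh (Ico u v) m) := by
    intro m
    induction m with
    | zero => exact .ico u v
    | succ m ih => exact (E.isIcoUnion_image_map (fresh_subset hV m) ih).diff_ico u v
  have hmem : ∀ m, m < n → E.fresh (Ico u v) m ⊆ ⋃ m ∈ Finset.range n, E.fresh (Ico u v) m :=
    fun m hm x hx => mem_biUnion (Finset.mem_range.2 hm) hx
  have hW := hue.eq_of_mapsTo (W := ⋃ m ∈ Finset.range n, E.fresh (Ico u v) m)
    (iUnion₂_subset fun m _ => fresh_subset hV m) (.biUnion _ fun m _ => hIco m)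
    ⟨u, hmem 0 hn0 (left_mem_Ico.2 huv)⟩
    (by
      intro x hx
      obtain ⟨m, hm, hxm⟩ := mem_iUnion₂.1 hx
      rw [Finset.mem_range] at hm
      by_cases hV' : E.map x ∈ Ico u v
      · exact hmem 0 hn0 hV'
      have h1 : E.map x ∈ E.fresh (Ico u v) (m + 1) := ⟨mem_image_of_mem _ hxm, hV'⟩
      rcases Nat.lt_or_ge (m + 1) n with h | h
      · exact hmem _ h h1
      · obtain rfl : m + 1 = n := by omega
        rw [hn] at h1
        exact h1.elim)
  refine ⟨n, fun x hx => ?_⟩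
  have hx' : E.map^[n] x ∈ ⋃ m ∈ Finset.range n, E.fresh (Ico u v) m := by
    rw [hW]
    exact E.iterate_map_mem hx n
  obtain ⟨m, hm, hxm⟩ := mem_iUnion₂.1 hx'
  rw [Finset.mem_range] at hm
  obtain ⟨y, hy, hyx⟩ := exists_of_mem_fresh hxm
  refine ⟨n - m, Nat.sub_le _ _, ?_⟩
  have h2 : E.map^[m] y = E.map^[m] (E.map^[n - m] x) := by
    rw [hyx, ← Function.iterate_add_apply, Nat.add_sub_cancel' hm.le]
  rwa [← E.iterate_map_injOn m (hV hy) (E.iterate_map_mem hx _) h2]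

end IET

namespace IET

variable {N : ℕ} {E : IET N}

namespace Renormalization

variable (r : E.Renormalization)

/-! ### The tiles of a renormalization -/

/-- The prefix of length `l` of the word `σ i`. -/
def prefixOf (i : Fin N) (l : Fin (r.σ i).length) : r.Prefix := Sigma.mk i l

noncomputable instance : Fintype r.Prefix :=
  inferInstanceAs (Fintype (Σ i : Fin N, Fin (r.σ i).length))

lemma scale_mem {x : ℝ} (hx : x ∈ Ico (0 : ℝ) 1) : r.a + r.ρ * x ∈ Ico r.a (r.a + r.ρ) := by
  have h1 := mul_nonneg r.ρ_pos.le hx.1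
  have h2 := mul_lt_mul_of_pos_left hx.2 r.ρ_pos
  constructor <;> linarith

lemma scale_mem_unit {x : ℝ} (hx : x ∈ Ico (0 : ℝ) 1) : r.a + r.ρ * x ∈ Ico (0 : ℝ) 1 :=
  ⟨r.a_nonneg.trans (r.scale_mem hx).1, (r.scale_mem hx).2.trans_le r.le_one⟩

lemma iterate_map_scale {i : Fin N} {x : ℝ} (hx : x ∈ E.atom i) {l : ℕ}
    (hl : l ≤ (r.σ i).length) :
    E.map^[l] (r.a + r.ρ * x) = r.a + r.ρ * x + (((r.σ i).take l).map E.trans).sum := by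
  induction l with
  | zero => simp
  | succ l ih =>
    rw [Function.iterate_succ_apply', E.map_of_mem_atom (r.itinerary i x hx l hl),
      ih (Nat.le_of_succ_le hl), List.take_add_one, List.getElem?_eq_getElem hl,
      List.map_append, List.sum_append, ← add_assoc]
    simp only [Option.toList_some, List.map_cons, List.map_nil, List.sum_cons, List.sum_nil,
      add_zero]

lemma iterate_map_eq_tileMap (p : r.Prefix) {x : ℝ} (hx : x ∈ E.atom p.exponent) :
    E.map^[p.2] (r.a + r.ρ * x) = p.tileMap x :=
  r.iterate_map_scale hx p.2.2.le

lemma tileMap_mem (p : r.Prefix) {x : ℝ} (hx : x ∈ E.atom p.exponent) :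
    p.tileMap x ∈ E.atom p.next := by
  rw [← r.iterate_map_eq_tileMap p hx]
  exact r.itinerary p.1 x hx p.2 p.2.2

lemma tileMap_sub (p : r.Prefix) (x y : ℝ) : p.tileMap x - p.tileMap y = r.ρ * (x - y) := by
  simp only [Prefix.tileMap]
  ring

lemma tileMap_injective (p : r.Prefix) : Function.Injective p.tileMap := by
  intro x y h
  have := r.tileMap_sub p x y
  rw [h, sub_self, eq_comm, mul_eq_zero, sub_eq_zero] at this
  exact this.resolve_left r.ρ_pos.ne'

lemma image_tileMap_ico (p : r.Prefix) (u v : ℝ) :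
    p.tileMap '' Ico u v = Ico (p.tileMap u) (p.tileMap v) := by
  have hρ := r.ρ_pos
  ext x
  constructor
  · rintro ⟨y, hy, rfl⟩
    have h1 := r.tileMap_sub p y u
    have h2 := r.tileMap_sub p v y
    have h3 := mul_nonneg hρ.le (sub_nonneg.2 hy.1)
    have h4 := mul_pos hρ (sub_pos.2 hy.2)
    constructor <;> linarith
  · rintro ⟨h1, h2⟩
    refine ⟨(x - r.a - p.trans) / r.ρ, ?_, ?_⟩
    · simp only [Prefix.tileMap] at h1 h2
      rw [mem_Ico, le_div_iff₀ hρ, div_lt_iff₀ hρ]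
      constructor <;> linarith
    · simp only [Prefix.tileMap]
      field_simp
      ring

/-- Tiles are disjoint: two of them are floors of towers over disjoint parts of the interval of
induction, and a tower does not return to that interval below its top. -/
lemma tile_unique {p q : r.Prefix} {x y : ℝ} (hx : x ∈ E.atom p.exponent)
    (hy : y ∈ E.atom q.exponent) (h : p.tileMap x = q.tileMap y) : p = q ∧ x = y := by
  wlog hle : (p.2 : ℕ) ≤ q.2 generalizing p q x y
  · obtain ⟨h1, h2⟩ := this hy hx h.symm (le_of_not_ge hle)
    exact ⟨h1.symm, h2.symm⟩
  have hxI := E.atom_subset _ hx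
  have hyI := E.atom_subset _ hy
  have h1 : r.a + r.ρ * x = E.map^[(q.2 : ℕ) - p.2] (r.a + r.ρ * y) := by
    refine E.iterate_map_injOn p.2 (r.scale_mem_unit hxI)
      (E.iterate_map_mem (r.scale_mem_unit hyI) _) ?_
    rw [r.iterate_map_eq_tileMap p hx, h, ← r.iterate_map_eq_tileMap q hy,
      ← Function.iterate_add_apply, Nat.add_sub_cancel' hle]
  have h2 : (p.2 : ℕ) = q.2 := by
    by_contra hne
    refine r.not_return q.1 y hy ((q.2 : ℕ) - p.2) (by omega) ((Nat.sub_le _ _).trans_lt q.2.2) ?_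
    rw [← h1]
    exact r.scale_mem hxI
  rw [h2, Nat.sub_self, Function.iterate_zero, id, add_right_inj] at h1
  have hxy : x = y := mul_left_cancel₀ r.ρ_pos.ne' h1
  subst hxy
  have h3 : p.1 = q.1 := E.atom_unique hx hy
  refine ⟨?_, rfl⟩
  obtain ⟨i, l⟩ := p
  obtain ⟨j, m⟩ := q
  obtain rfl : i = j := h3
  obtain rfl : l = m := Fin.ext h2
  rfl

lemma scale_eq_tileMap {x : ℝ} {i : Fin N} :
    r.a + r.ρ * x = (r.prefixOf i ⟨0, List.length_pos_iff.2 (r.σ_ne_nil i)⟩).tileMap x := by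
  simp [Prefix.tileMap, Prefix.trans, prefixOf]

/-- The exchange moves a point within its tower, or from the top of a tower to the base. -/
lemma map_tileMap (p : r.Prefix) {x : ℝ} (hx : x ∈ E.atom p.exponent) :
    (∃ q : r.Prefix, q.exponent = p.exponent ∧ E.map (p.tileMap x) = q.tileMap x) ∨
      E.map (p.tileMap x) = r.a + r.ρ * E.map x := by
  rw [← r.iterate_map_eq_tileMap p hx, ← Function.iterate_succ_apply' E.map]
  rcases Nat.lt_or_ge ((p.2 : ℕ) + 1) (r.σ p.1).length with h | h
  · left
    refine ⟨r.prefixOf p.1 ⟨p.2 + 1, h⟩, rfl, ?_⟩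
    exact r.iterate_map_eq_tileMap (r.prefixOf p.1 ⟨p.2 + 1, h⟩) hx
  · right
    rw [← r.first_return p.1 x hx]
    congr 1
    have := p.2.2
    omega

/-- Tiles cover the unit interval, since their union is forward invariant. -/
lemma exists_tile (hue : E.UniquelyErgodic) {x : ℝ} (hx : x ∈ Ico (0 : ℝ) 1) :
    ∃ p : r.Prefix, ∃ y ∈ E.atom p.exponent, p.tileMap y = x := by
  have hW := hue.eq_of_mapsTo (W := ⋃ p : r.Prefix, p.tileMap '' E.atom p.exponent)
    (iUnion_subset fun p => by
      rintro _ ⟨y, hy, rfl⟩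
      exact E.atom_subset _ (r.tileMap_mem p hy))
    (.iUnion fun p => by
      rw [atom, image_tileMap_ico]
      exact .ico _ _)
    (by
      obtain ⟨i, hi⟩ := E.exists_mem_atom hx
      exact ⟨_, mem_iUnion.2
        ⟨r.prefixOf i ⟨0, List.length_pos_iff.2 (r.σ_ne_nil i)⟩, mem_image_of_mem _ hi⟩⟩)
    (by
      intro z hz
      obtain ⟨p, y, hy, rfl⟩ := mem_iUnion.1 hz
      rcases r.map_tileMap p hy with ⟨q, hq, h⟩ | h
      · rw [h]
        exact mem_iUnion.2 ⟨q, mem_image_of_mem _ (hq ▸ hy)⟩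
      · obtain ⟨j, hj⟩ := E.exists_mem_atom (E.map_mem (E.atom_subset _ hy))
        rw [h, r.scale_eq_tileMap (i := j)]
        exact mem_iUnion.2 ⟨r.prefixOf j _, mem_image_of_mem _ hj⟩)
  rw [← hW] at hx
  obtain ⟨p, y, hy, rfl⟩ := mem_iUnion.1 hx
  exact ⟨p, y, hy, rfl⟩

/-! ### Vershik codes as itineraries of the desubstitution map -/

instance instNonemptyPrefix : Nonempty r.Prefix := by
  obtain ⟨i, -⟩ := E.exists_mem_atom (x := 0) ⟨le_rfl, one_pos⟩
  exact ⟨r.prefixOf i ⟨0, List.length_pos_iff.2 (r.σ_ne_nil i)⟩⟩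

/-- The prefix `μ` whose tile contains `x` (arbitrary if there is none). -/
noncomputable def address (x : ℝ) : r.Prefix :=
  Classical.epsilon fun p : r.Prefix => ∃ y ∈ E.atom p.exponent, p.tileMap y = x

/-- The desubstitution map: the inverse of the tile map on each tile. -/
noncomputable def desub (x : ℝ) : ℝ := (x - r.a - (r.address x).trans) / r.ρ

lemma tileMap_desub (x : ℝ) : (r.address x).tileMap (r.desub x) = x := by
  have := r.ρ_pos.ne'
  rw [Prefix.tileMap, desub]
  field_simp
  ring

lemma address_tileMap {p : r.Prefix} {y : ℝ} (hy : y ∈ E.atom p.exponent) :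
    r.address (p.tileMap y) = p := by
  obtain ⟨z, hz, h⟩ := Classical.epsilon_spec
    (p := fun q : r.Prefix => ∃ z ∈ E.atom q.exponent, q.tileMap z = p.tileMap y) ⟨p, y, hy, rfl⟩
  exact (r.tile_unique hz hy h).1

lemma desub_tileMap {p : r.Prefix} {y : ℝ} (hy : y ∈ E.atom p.exponent) :
    r.desub (p.tileMap y) = y := by
  have h := r.tileMap_desub (p.tileMap y)
  rw [r.address_tileMap hy] at h
  exact r.tileMap_injective p h

lemma desub_scale {y : ℝ} (hy : y ∈ Ico (0 : ℝ) 1) : r.desub (r.a + r.ρ * y) = y := by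
  obtain ⟨i, hi⟩ := E.exists_mem_atom hy
  rw [r.scale_eq_tileMap (i := i)]
  exact r.desub_tileMap hi

variable {r}

lemma desub_mem_atom (hue : E.UniquelyErgodic) {x : ℝ} (hx : x ∈ Ico (0 : ℝ) 1) :
    r.desub x ∈ E.atom (r.address x).exponent := by
  obtain ⟨p, y, hy, rfl⟩ := r.exists_tile hue hx
  rwa [r.desub_tileMap hy, r.address_tileMap hy]

lemma desub_mem (hue : E.UniquelyErgodic) {x : ℝ} (hx : x ∈ Ico (0 : ℝ) 1) :
    r.desub x ∈ Ico (0 : ℝ) 1 :=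
  E.atom_subset _ (desub_mem_atom hue hx)

lemma iterate_desub_mem (hue : E.UniquelyErgodic) {x : ℝ} (hx : x ∈ Ico (0 : ℝ) 1) (n : ℕ) :
    r.desub^[n] x ∈ Ico (0 : ℝ) 1 := by
  induction n with
  | zero => exact hx
  | succ n ih => rw [Function.iterate_succ_apply']; exact desub_mem hue ih

lemma mem_atom_next (hue : E.UniquelyErgodic) {x : ℝ} (hx : x ∈ Ico (0 : ℝ) 1) :
    x ∈ E.atom (r.address x).next := by
  have h := r.tileMap_mem _ (desub_mem_atom hue hx)
  rwa [r.tileMap_desub] at h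

lemma cylinderMap_succ (μ : ℕ → r.Prefix) (k : ℕ) :
    r.cylinderMap μ (k + 1) = (μ 0).tileMap ∘ r.cylinderMap (fun n => μ (n + 1)) k := by
  induction k with
  | zero => rfl
  | succ k ih =>
    rw [cylinderMap, ih]
    rfl

lemma isVershikCode_of_eq (hue : E.UniquelyErgodic) {x : ℝ} (hx : x ∈ Ico (0 : ℝ) 1) :
    r.IsVershikCode (fun k => r.address (r.desub^[k] x)) x := by
  refine ⟨fun k => ?_, fun k => ?_⟩
  · refine E.atom_unique (desub_mem_atom hue (iterate_desub_mem hue hx k)) ?_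
    beta_reduce
    rw [Function.iterate_succ_apply']
    exact mem_atom_next hue (desub_mem hue (iterate_desub_mem hue hx k))
  · refine ⟨r.desub^[k + 1] x, ?_, ?_⟩
    · rw [Function.iterate_succ_apply']
      exact desub_mem_atom hue (iterate_desub_mem hue hx k)
    · induction k with
      | zero => exact r.tileMap_desub x
      | succ k ih =>
        rw [cylinderMap, Function.comp_apply, Function.iterate_succ_apply' _ (k + 1),
          r.tileMap_desub, ih]

lemma IsVershikCode.mem {μ : ℕ → r.Prefix} {x : ℝ} (h : r.IsVershikCode μ x) :
    x ∈ Ico (0 : ℝ) 1 := by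
  obtain ⟨y, hy, rfl⟩ := h.2 0
  exact E.atom_subset _ (r.tileMap_mem (μ 0) hy)

lemma IsVershikCode.shift {μ : ℕ → r.Prefix} {x : ℝ} (h : r.IsVershikCode μ x) :
    μ 0 = r.address x ∧ r.IsVershikCode (fun n => μ (n + 1)) (r.desub x) := by
  obtain ⟨y, hy, rfl⟩ := h.2 0
  have h0 : r.address ((μ 0).tileMap y) = μ 0 := r.address_tileMap hy
  have h1 : r.desub ((μ 0).tileMap y) = y := r.desub_tileMap hy
  refine ⟨h0.symm, fun k => h.1 (k + 1), fun k => ?_⟩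
  obtain ⟨z, hz, hzy⟩ := h.2 (k + 1)
  rw [cylinderMap_succ] at hzy
  refine ⟨z, hz, ?_⟩
  change _ = r.desub ((μ 0).tileMap y)
  rw [h1]
  exact r.tileMap_injective _ hzy

lemma IsVershikCode.eq_address {μ : ℕ → r.Prefix} {x : ℝ} (h : r.IsVershikCode μ x) (k : ℕ) :
    μ k = r.address (r.desub^[k] x) := by
  induction k generalizing μ x with
  | zero => exact h.shift.1
  | succ k ih => exact ih h.shift.2

/-- A point is determined by its code, because the tile maps are contractions. -/
lemma eq_of_address_eq (hue : E.UniquelyErgodic) {x y : ℝ} (hx : x ∈ Ico (0 : ℝ) 1)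
    (hy : y ∈ Ico (0 : ℝ) 1)
    (h : ∀ k, r.address (r.desub^[k] x) = r.address (r.desub^[k] y)) : x = y := by
  have key : ∀ k, x - y = r.ρ ^ k * (r.desub^[k] x - r.desub^[k] y) := by
    intro k
    induction k with
    | zero => simp
    | succ k ih =>
      have h1 := r.tileMap_desub (r.desub^[k] x)
      have h2 := r.tileMap_desub (r.desub^[k] y)
      rw [← h k] at h2
      rw [ih, Function.iterate_succ_apply', Function.iterate_succ_apply', pow_succ, mul_assoc,
        ← r.tileMap_sub (r.address (r.desub^[k] x)), h1, h2]
  have hle : ∀ k, |x - y| ≤ r.ρ ^ k := by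
    intro k
    have h1 := iterate_desub_mem (r := r) hue hx k
    have h2 := iterate_desub_mem (r := r) hue hy k
    have h3 : |r.desub^[k] x - r.desub^[k] y| ≤ 1 :=
      abs_le.2 ⟨by linarith [h1.1, h2.2], by linarith [h1.2, h2.1]⟩
    rw [key k, abs_mul, abs_of_pos (pow_pos r.ρ_pos k)]
    exact mul_le_of_le_one_right (pow_pos r.ρ_pos k).le h3
  have h0 : |x - y| ≤ 0 :=
    ge_of_tendsto' (tendsto_pow_atTop_nhds_zero_of_lt_one r.ρ_pos.le r.ρ_lt_one) hle
  exact sub_eq_zero.1 (abs_nonpos_iff.1 h0)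

/-- Eventual periodicity of the code is eventual periodicity of the orbit under the
desubstitution map. -/
lemma eventuallyPeriodic_iff (hue : E.UniquelyErgodic) {T : ℕ} {x : ℝ} :
    r.EventuallyPeriodic T x ↔
      x ∈ Ico (0 : ℝ) 1 ∧ ∃ t, r.desub^[t + T] x = r.desub^[t] x := by
  constructor
  · rintro ⟨μ, hμ, t, ht⟩
    refine ⟨hμ.mem, t, eq_of_address_eq (r := r) hue (iterate_desub_mem hue hμ.mem _)
      (iterate_desub_mem hue hμ.mem _) fun k => ?_⟩
    rw [← Function.iterate_add_apply, ← Function.iterate_add_apply, ← hμ.eq_address,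
      ← hμ.eq_address, ← add_assoc]
    exact ht (k + t) (Nat.le_add_left t k)
  · rintro ⟨hx, t, ht⟩
    refine ⟨_, isVershikCode_of_eq hue hx, t, fun k hk => ?_⟩
    obtain ⟨l, rfl⟩ := Nat.exists_eq_add_of_le' hk
    rw [add_assoc, Function.iterate_add_apply, ht, ← Function.iterate_add_apply]

lemma eventuallyPeriodic_iterate_desub_iff (hue : E.UniquelyErgodic) {T : ℕ} {x : ℝ}
    (hx : x ∈ Ico (0 : ℝ) 1) (k : ℕ) :
    r.EventuallyPeriodic T (r.desub^[k] x) ↔ r.EventuallyPeriodic T x := by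
  rw [eventuallyPeriodic_iff hue, eventuallyPeriodic_iff hue]
  simp only [iterate_desub_mem hue hx k, hx, true_and, ← Function.iterate_add_apply]
  constructor
  · rintro ⟨t, ht⟩
    refine ⟨t + k, ?_⟩
    rwa [add_right_comm]
  · rintro ⟨t, ht⟩
    refine ⟨t, ?_⟩
    rw [add_comm (t + T) k, add_comm t k, Function.iterate_add_apply, ht,
      ← Function.iterate_add_apply]

lemma eventuallyPeriodicLeast_iterate_desub_iff (hue : E.UniquelyErgodic) {T : ℕ} {x : ℝ}
    (hx : x ∈ Ico (0 : ℝ) 1) (k : ℕ) :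
    r.EventuallyPeriodicLeast T (r.desub^[k] x) ↔ r.EventuallyPeriodicLeast T x := by
  simp only [EventuallyPeriodicLeast, eventuallyPeriodic_iterate_desub_iff hue hx]

lemma exists_periodic_of_eventuallyPeriodic (hue : E.UniquelyErgodic) {T : ℕ} {x : ℝ}
    (h : r.EventuallyPeriodic T x) : ∃ t, r.desub^[T] (r.desub^[t] x) = r.desub^[t] x := by
  obtain ⟨t, ht⟩ := ((eventuallyPeriodic_iff hue).1 h).2
  refine ⟨t, ?_⟩
  rw [← Function.iterate_add_apply, add_comm]
  exact ht

/-- If the interval of induction does not reach `1`, the fixed point of the rescaling lies in the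
unit interval, and it is a fixed point of the desubstitution map. -/
lemma exists_eventuallyPeriodic (hue : E.UniquelyErgodic) (h : r.a + r.ρ ≠ 1) (T : ℕ) :
    ∃ x ∈ Ico (0 : ℝ) 1, r.EventuallyPeriodic T x := by
  have h1 : r.a + r.ρ < 1 := lt_of_le_of_ne r.le_one h
  have h2 : 0 < 1 - r.ρ := sub_pos.2 r.ρ_lt_one
  have hx : r.a / (1 - r.ρ) ∈ Ico (0 : ℝ) 1 :=
    ⟨div_nonneg r.a_nonneg h2.le, (div_lt_one h2).2 (by linarith)⟩
  have hfix : r.a + r.ρ * (r.a / (1 - r.ρ)) = r.a / (1 - r.ρ) := by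
    field_simp
    ring
  have hD : r.desub (r.a / (1 - r.ρ)) = r.a / (1 - r.ρ) := by
    have := r.desub_scale hx
    rwa [hfix] at this
  exact ⟨_, hx, (eventuallyPeriodic_iff hue).2 ⟨hx, 0, Function.iterate_fixed hD _⟩⟩

end Renormalization

end IET

namespace IET

variable {N : ℕ} {E : IET N}

/-- Displacements in bounded time are bounded away from zero: they take finitely many values. -/
lemma UniquelyErgodic.exists_displacement_bound (hue : E.UniquelyErgodic) (L : ℕ) :
    ∃ ε > 0, ∀ x ∈ Ico (0 : ℝ) 1, ∀ l, 0 < l → l ≤ L → ε ≤ |E.map^[l] x - x| := by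
  classical
  have hfin : ∀ l, ∃ F : Finset ℝ, ∀ x ∈ Ico (0 : ℝ) 1, E.map^[l] x - x ∈ F := by
    intro l
    induction l with
    | zero => exact ⟨{0}, fun x _ => by simp⟩
    | succ l ih =>
      obtain ⟨F, hF⟩ := ih
      refine ⟨Finset.image₂ (· + ·) F (Finset.univ.image E.trans), fun x hx => ?_⟩
      obtain ⟨i, hi⟩ := E.exists_mem_atom (E.iterate_map_mem hx l)
      rw [Function.iterate_succ_apply', E.map_of_mem_atom hi, add_sub_right_comm]
      exact Finset.mem_image₂_of_mem (hF x hx) (Finset.mem_image_of_mem _ (Finset.mem_univ i))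
  have hmin : ∀ F : Finset ℝ, ∃ ε > 0, ∀ f ∈ F, f ≠ 0 → ε ≤ |f| := by
    intro F
    induction F using Finset.induction_on with
    | empty => exact ⟨1, one_pos, by simp⟩
    | insert a F _ ih =>
      obtain ⟨ε, hε, h⟩ := ih
      rcases eq_or_ne a 0 with rfl | ha
      · refine ⟨ε, hε, fun f hf hf0 => h f ?_ hf0⟩
        exact (Finset.mem_insert.1 hf).resolve_left hf0
      · refine ⟨min ε |a|, lt_min hε (abs_pos.2 ha), fun f hf hf0 => ?_⟩
        rcases Finset.mem_insert.1 hf with rfl | hf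
        · exact min_le_right _ _
        · exact (min_le_left _ _).trans (h f hf hf0)
  choose F hF using hfin
  obtain ⟨ε, hε, h⟩ := hmin ((Finset.range (L + 1)).biUnion F)
  refine ⟨ε, hε, fun x hx l hl hlL => h _ ?_ (sub_ne_zero.2 (hue.iterate_map_ne hx hl))⟩
  exact Finset.mem_biUnion.2 ⟨l, Finset.mem_range.2 (by omega), hF l x hx⟩

namespace Renormalization

variable {r : E.Renormalization}

/-! ### Every atom occurs in all towers of a high level -/

lemma iterate_scale_mem {x : ℝ} (hx : x ∈ Ico (0 : ℝ) 1) (m : ℕ) :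
    (fun x => r.a + r.ρ * x)^[m] x ∈ Ico (0 : ℝ) 1 := by
  induction m with
  | zero => exact hx
  | succ m ih => rw [Function.iterate_succ_apply']; exact r.scale_mem_unit ih

lemma iterate_scale_sub (x y : ℝ) (m : ℕ) :
    (fun x => r.a + r.ρ * x)^[m] x - (fun x => r.a + r.ρ * x)^[m] y = r.ρ ^ m * (x - y) := by
  induction m with
  | zero => simp
  | succ m ih =>
    rw [Function.iterate_succ_apply', Function.iterate_succ_apply', pow_succ', mul_assoc, ← ih]
    ring

lemma iterate_desub_iterate_scale {x : ℝ} (hx : x ∈ Ico (0 : ℝ) 1) (m : ℕ) :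
    r.desub^[m] ((fun x => r.a + r.ρ * x)^[m] x) = x := by
  induction m with
  | zero => rfl
  | succ m ih =>
    rw [Function.iterate_succ_apply' (fun x => r.a + r.ρ * x), Function.iterate_succ_apply,
      r.desub_scale (iterate_scale_mem hx m), ih]

lemma desub_map (hue : E.UniquelyErgodic) {x : ℝ} (hx : x ∈ Ico (0 : ℝ) 1) :
    r.desub (E.map x) = r.desub x ∨ E.map x = r.a + r.ρ * E.map (r.desub x) := by
  obtain ⟨p, y, hy, rfl⟩ := r.exists_tile hue hx
  rw [r.desub_tileMap hy]
  refine (r.map_tileMap p hy).imp_left ?_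
  rintro ⟨q, hq, h⟩
  rw [h]
  exact r.desub_tileMap (hq ▸ hy)

/-- A point stays in its tower of level `m`, unless it is moved to the base of the towers. -/
lemma iterate_desub_map (hue : E.UniquelyErgodic) (m : ℕ) {x : ℝ} (hx : x ∈ Ico (0 : ℝ) 1) :
    r.desub^[m] (E.map x) = r.desub^[m] x ∨
      ∃ u ∈ Ico (0 : ℝ) 1, E.map x = (fun x => r.a + r.ρ * x)^[m] u := by
  induction m generalizing x with
  | zero => exact Or.inr ⟨_, E.map_mem hx, rfl⟩
  | succ m ih =>
    rcases desub_map (r := r) hue hx with h | h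
    · left
      rw [Function.iterate_succ_apply, h, ← Function.iterate_succ_apply]
    · have hD := desub_mem (r := r) hue hx
      rcases ih hD with h' | ⟨u, hu, h'⟩
      · left
        rw [h, Function.iterate_succ_apply, r.desub_scale (E.map_mem hD), h',
          ← Function.iterate_succ_apply]
      · right
        exact ⟨u, hu, by rw [h, h', Function.iterate_succ_apply']⟩

/-- The towers of a high level are so high that each of them meets every atom: a return to their
narrow base is a small displacement, which takes long, and visits to the atoms are frequent. -/
lemma exists_level_meets_atoms (hue : E.UniquelyErgodic) :
    ∃ m : ℕ, ∀ y ∈ Ico (0 : ℝ) 1, ∀ i, ∃ z ∈ E.atom i, r.desub^[m] z = y := by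
  choose L hL using fun i => hue.exists_visit_bound
    (lt_add_of_pos_right (E.left i) (E.len_pos i)) (E.atom_subset i)
  obtain ⟨ε, hε, hdisp⟩ := hue.exists_displacement_bound (Finset.univ.sup L)
  obtain ⟨m, hm⟩ := exists_pow_lt_of_lt_one hε r.ρ_lt_one
  refine ⟨m, fun y hy i => ?_⟩
  set x := (fun x => r.a + r.ρ * x)^[m] y with hxdef
  have hx : x ∈ Ico (0 : ℝ) 1 := iterate_scale_mem hy m
  have key : ∀ l, l ≤ Finset.univ.sup L → r.desub^[m] (E.map^[l] x) = y := by
    intro l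
    induction l with
    | zero => exact fun _ => iterate_desub_iterate_scale hy m
    | succ l ih =>
      intro hl
      rw [Function.iterate_succ_apply']
      rcases iterate_desub_map (r := r) hue m (E.iterate_map_mem hx l) with h | ⟨u, hu, h⟩
      · rw [h, ih (Nat.le_of_succ_le hl)]
      · have h1 := hdisp x hx (l + 1) l.succ_pos hl
        rw [Function.iterate_succ_apply', h, hxdef, iterate_scale_sub, abs_mul,
          abs_of_pos (pow_pos r.ρ_pos m)] at h1
        have h2 : |u - y| ≤ 1 := abs_le.2 ⟨by linarith [hu.1, hy.2], by linarith [hu.2, hy.1]⟩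
        have h3 := mul_le_of_le_one_right (pow_pos r.ρ_pos m).le h2
        linarith
  obtain ⟨l, hl, hmem⟩ := hL i x hx
  exact ⟨_, hmem, key l (hl.trans (Finset.le_sup (Finset.mem_univ i)))⟩

/-! ### Counting preimages under the desubstitution map -/

variable (r) in
/-- The length of the word `σ^k j`, which is the number of preimages under the `k`-th iterate of
the desubstitution map of a point of the `j`-th atom. -/
def height : ℕ → Fin N → ℕ
  | 0, _ => 1
  | k + 1, j => ∑ l : Fin (r.σ j).length, height k (r.σ j)[l]

lemma exists_preimages (hue : E.UniquelyErgodic) (k : ℕ) {j : Fin N} {y : ℝ}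
    (hy : y ∈ E.atom j) :
    ∃ s : Finset ℝ, s.card = r.height k j ∧
      ∀ z, z ∈ s ↔ z ∈ Ico (0 : ℝ) 1 ∧ r.desub^[k] z = y := by
  classical
  induction k generalizing j y with
  | zero =>
    refine ⟨{y}, rfl, fun z => ?_⟩
    rw [Finset.mem_singleton]
    exact ⟨fun h => ⟨h ▸ E.atom_subset _ hy, h⟩, fun h => h.2⟩
  | succ k ih =>
    have hnext : ∀ l : Fin (r.σ j).length, (r.prefixOf j l).tileMap y ∈ E.atom (r.σ j)[l] :=
      fun l => r.tileMap_mem (r.prefixOf j l) hy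
    choose s hcard hs using fun l => ih (hnext l)
    refine ⟨Finset.univ.biUnion s, ?_, fun z => ?_⟩
    · rw [Finset.card_biUnion]
      · exact Finset.sum_congr rfl fun l _ => hcard l
      · intro l _ l' _ hll
        refine Finset.disjoint_left.2 fun z h1 h2 => hll ?_
        have h3 := ((hs l z).1 h1).2.symm.trans ((hs l' z).1 h2).2
        have h4 := (r.tile_unique (p := r.prefixOf j l) (q := r.prefixOf j l') hy hy h3).1
        exact eq_of_heq (Sigma.mk.inj h4).2
    · simp only [Finset.mem_biUnion, Finset.mem_univ, true_and, hs]
      rw [Function.iterate_succ_apply']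
      constructor
      · rintro ⟨l, hz, h⟩
        exact ⟨hz, by rw [h]; exact r.desub_tileMap (p := r.prefixOf j l) hy⟩
      · rintro ⟨hz, h⟩
        have hw := iterate_desub_mem (r := r) hue hz k
        have h1 := r.tileMap_desub (r.desub^[k] z)
        have h2 := desub_mem_atom (r := r) hue hw
        rw [h] at h1 h2
        generalize r.address (r.desub^[k] z) = p at h1 h2
        obtain ⟨i, l⟩ := p
        obtain rfl : i = j := E.atom_unique h2 hy
        exact ⟨l, hz, h1.symm⟩

lemma sum_next_eq (w : Fin N → ℝ) (j : Fin N) :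
    ∑ l : Fin (r.σ j).length, w (r.σ j)[l] = ∑ i, (r.incidence i j : ℝ) * w i := by
  have key : ∀ s : List (Fin N), ∑ l : Fin s.length, w s[l] = ∑ i, (s.count i : ℝ) * w i := by
    intro s
    induction s with
    | nil => simp
    | cons b s ih =>
      simp only [List.length_cons]
      rw [Fin.sum_univ_succ]
      simp only [List.count_cons, Nat.cast_add, add_mul, Finset.sum_add_distrib, ← ih]
      simp [add_comm]
  simpa [incidence] using key (r.σ j)

lemma volume_tile (p : r.Prefix) :
    volume (p.tileMap '' E.atom p.exponent) = ENNReal.ofReal (r.ρ * E.len p.exponent) := by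
  rw [atom, image_tileMap_ico, Real.volume_Ico, r.tileMap_sub, add_sub_cancel_left]

/-- The lengths form an eigenvector of the incidence matrix, since an atom is the disjoint union
of the tiles that it meets. -/
lemma incidence_mul_len (hue : E.UniquelyErgodic) (i : Fin N) :
    ∑ j, (r.incidence i j : ℝ) * E.len j = r.ρ⁻¹ * E.len i := by
  classical
  have hU : E.atom i = ⋃ p ∈ Finset.univ.filter (fun p : r.Prefix => p.next = i),
      p.tileMap '' E.atom p.exponent := by
    ext x
    simp only [Finset.mem_filter, Finset.mem_univ, true_and, mem_iUnion, exists_prop]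
    constructor
    · intro hx
      obtain ⟨p, y, hy, rfl⟩ := r.exists_tile hue (E.atom_subset _ hx)
      exact ⟨p, E.atom_unique (r.tileMap_mem p hy) hx, y, hy, rfl⟩
    · rintro ⟨p, rfl, y, hy, rfl⟩
      exact r.tileMap_mem p hy
  have hv : volume (E.atom i) = ∑ p ∈ Finset.univ.filter (fun p : r.Prefix => p.next = i),
      ENNReal.ofReal (r.ρ * E.len p.exponent) := by
    rw [hU, measure_biUnion_finset]
    · exact Finset.sum_congr rfl fun p _ => volume_tile p
    · intro p _ q _ hpq
      refine disjoint_left.2 ?_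
      rintro _ ⟨x, hx, rfl⟩ ⟨y, hy, h⟩
      exact hpq (r.tile_unique hy hx h).1.symm
    · intro p _
      rw [atom, image_tileMap_ico]
      exact measurableSet_Ico
  have hnn : ∀ p : r.Prefix, 0 ≤ r.ρ * E.len p.exponent := fun p =>
    mul_nonneg r.ρ_pos.le (E.len_pos _).le
  rw [atom, Real.volume_Ico, add_sub_cancel_left,
    ← ENNReal.ofReal_sum_of_nonneg fun p _ => hnn p,
    ENNReal.ofReal_eq_ofReal_iff (E.len_pos i).le (Finset.sum_nonneg fun p _ => hnn p),
    Finset.sum_filter] at hv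
  have hs : ∑ p : r.Prefix, (if p.next = i then r.ρ * E.len p.exponent else 0) =
      ∑ j, ∑ l : Fin (r.σ j).length, if (r.σ j)[l] = i then r.ρ * E.len j else 0 :=
    Fintype.sum_sigma _
  rw [hs] at hv
  rw [eq_inv_mul_iff_mul_eq₀ r.ρ_pos.ne', hv, Finset.mul_sum]
  refine Finset.sum_congr rfl fun j _ => ?_
  rw [sum_next_eq (fun i' => if i' = i then r.ρ * E.len j else 0)]
  simp
  ring

lemma sum_height_mul_len (hue : E.UniquelyErgodic) (k : ℕ) :
    ∑ j, (r.height k j : ℝ) * E.len j = r.ρ⁻¹ ^ k := by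
  induction k with
  | zero => simp [height, E.len_sum]
  | succ k ih =>
    have h1 : ∀ j, (r.height (k + 1) j : ℝ) = ∑ i, (r.incidence i j : ℝ) * r.height k i := by
      intro j
      rw [height, Nat.cast_sum]
      exact sum_next_eq (fun i => (r.height k i : ℝ)) j
    simp only [h1, Finset.sum_mul]
    rw [Finset.sum_comm, pow_succ', ← ih, Finset.mul_sum]
    refine Finset.sum_congr rfl fun i _ => ?_
    rw [mul_left_comm, ← incidence_mul_len hue i, Finset.mul_sum]
    exact Finset.sum_congr rfl fun j _ => by ring

lemma height_le_height_add (hue : E.UniquelyErgodic) {m : ℕ}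
    (hm : ∀ y ∈ Ico (0 : ℝ) 1, ∀ i, ∃ z ∈ E.atom i, r.desub^[m] z = y) (k : ℕ) (i j : Fin N) :
    r.height k i ≤ r.height (k + m) j := by
  have hy := E.left_mem_atom j
  obtain ⟨z, hz, hzy⟩ := hm _ (E.atom_subset j hy) i
  obtain ⟨s, hs, hs'⟩ := exists_preimages (r := r) hue k hz
  obtain ⟨t, ht, ht'⟩ := exists_preimages (r := r) hue (k + m) hy
  rw [← hs, ← ht]
  refine Finset.card_le_card fun w hw => ?_
  obtain ⟨h1, h2⟩ := (hs' w).1 hw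
  exact (ht' w).2 ⟨h1, by rw [add_comm, Function.iterate_add_apply, h2, hzy]⟩

/-- The numbers of preimages of all points grow at the same rate. -/
lemma exists_le_height (hue : E.UniquelyErgodic) :
    ∃ c > 0, ∀ k j, c * r.ρ⁻¹ ^ k ≤ r.height k j := by
  obtain ⟨m, hm⟩ := exists_level_meets_atoms (r := r) hue
  refine ⟨r.ρ ^ m, pow_pos r.ρ_pos m, fun k j => ?_⟩
  rcases le_total m k with h | h
  · obtain ⟨k, rfl⟩ := Nat.exists_eq_add_of_le' h
    rw [pow_add, mul_comm, mul_assoc, ← mul_pow, inv_mul_cancel₀ r.ρ_pos.ne', one_pow, mul_one,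
      ← sum_height_mul_len hue k, ← mul_one (r.height (k + m) j : ℝ), ← E.len_sum,
      Finset.mul_sum]
    refine Finset.sum_le_sum fun i _ => mul_le_mul_of_nonneg_right ?_ (E.len_pos i).le
    exact_mod_cast height_le_height_add hue hm k i j
  · have h1 : 1 ≤ r.height k j := by
      obtain ⟨s, hs, hs'⟩ := exists_preimages (r := r) hue k (E.left_mem_atom j)
      rw [← hs, Nat.one_le_iff_ne_zero, Finset.card_ne_zero]
      have hl := E.atom_subset j (E.left_mem_atom j)
      exact ⟨_, (hs' _).2 ⟨iterate_scale_mem hl k, iterate_desub_iterate_scale hl k⟩⟩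
    obtain ⟨n, rfl⟩ := Nat.exists_eq_add_of_le' h
    rw [pow_add, mul_assoc, ← mul_pow, mul_inv_cancel₀ r.ρ_pos.ne', one_pow, mul_one]
    exact (pow_le_one₀ r.ρ_pos.le r.ρ_lt_one.le).trans (by exact_mod_cast h1)

end Renormalization

end IET

namespace IET

variable {N : ℕ} {E : IET N}

/-! ### The module of the exchange is stable under rescaling -/

variable (E) in
lemma len_mem_module (i : Fin N) : E.len i ∈ E.module := Submodule.subset_span ⟨i, rfl⟩

variable (E) in
lemma left_mem_module (i : Fin N) : E.left i ∈ E.module :=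
  Submodule.sum_mem _ fun j _ => E.len_mem_module j

variable (E) in
lemma trans_mem_module (i : Fin N) : E.trans i ∈ E.module :=
  Submodule.sub_mem _ (Submodule.sum_mem _ fun j _ => E.len_mem_module j) (E.left_mem_module i)

variable (E) in
lemma one_mem_module : (1 : ℝ) ∈ E.module := by
  rw [← E.len_sum]
  exact Submodule.sum_mem _ fun j _ => E.len_mem_module j

lemma mem_field_of_mem_module {x : ℝ} (hx : x ∈ E.module) : x ∈ E.field := by
  induction hx using Submodule.span_induction with
  | mem x hx => exact IntermediateField.subset_adjoin ℚ _ hx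
  | zero => exact E.field.zero_mem
  | add x y _ _ hx hy => exact E.field.add_mem hx hy
  | smul a x _ hx => exact zsmul_mem hx a

namespace Renormalization

variable {r : E.Renormalization}

lemma prefix_trans_mem_module (p : r.Prefix) : p.trans ∈ E.module := by
  refine list_sum_mem fun x hx => ?_
  obtain ⟨j, -, rfl⟩ := List.mem_map.1 hx
  exact E.trans_mem_module j

lemma inv_mul_mem_module (hue : E.UniquelyErgodic) {x : ℝ} (hx : x ∈ E.module) :
    r.ρ⁻¹ * x ∈ E.module := by
  induction hx using Submodule.span_induction with
  | mem x hx =>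
    obtain ⟨i, rfl⟩ := hx
    rw [← incidence_mul_len hue i]
    refine Submodule.sum_mem _ fun j _ => ?_
    rw [← zsmul_eq_mul]
    exact Submodule.smul_mem _ _ (E.len_mem_module j)
  | zero => simp
  | add x y _ _ hx hy => rw [mul_add]; exact Submodule.add_mem _ hx hy
  | smul a x _ hx => rw [mul_smul_comm]; exact Submodule.smul_mem _ _ hx

lemma scale_mul_trans (i : Fin N) : r.ρ * E.trans i = ((r.σ i).map E.trans).sum := by
  have h1 := r.first_return i _ (E.left_mem_atom i)
  rw [r.iterate_map_scale (E.left_mem_atom i) le_rfl, List.take_length,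
    E.map_of_mem_atom (E.left_mem_atom i)] at h1
  linarith

/-- The scaling factor is an algebraic integer: it preserves the module of the translations. -/
lemma isIntegral_scale (hue : E.UniquelyErgodic) : IsIntegral ℤ r.ρ := by
  obtain ⟨i, hi⟩ := E.exists_mem_atom (x := 0) ⟨le_rfl, one_pos⟩
  refine isIntegral_of_smul_mem_submodule (Submodule.span ℤ (Set.range E.trans)) ?_
    (Submodule.fg_span (Set.finite_range _)) r.ρ fun x hx => ?_
  · intro h
    have h0 : E.trans i = 0 := by
      rw [← Submodule.mem_bot ℤ, ← h]
      exact Submodule.subset_span ⟨i, rfl⟩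
    refine hue.iterate_map_ne (E.atom_subset i hi) one_pos ?_
    rw [Function.iterate_one, E.map_of_mem_atom hi, h0, add_zero]
  · rw [smul_eq_mul]
    induction hx using Submodule.span_induction with
    | mem x hx =>
      obtain ⟨j, rfl⟩ := hx
      rw [scale_mul_trans]
      refine list_sum_mem fun x hx => ?_
      obtain ⟨j, -, rfl⟩ := List.mem_map.1 hx
      exact Submodule.subset_span ⟨j, rfl⟩
    | zero => simp
    | add x y _ _ hx hy => rw [mul_add]; exact Submodule.add_mem _ hx hy
    | smul a x _ hx => rw [mul_smul_comm]; exact Submodule.smul_mem _ _ hx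

/-- The module is stable under the inverse of the scaling factor, and the scaling factor, being an
algebraic integer, is an integral polynomial in its inverse. -/
lemma mul_mem_module (hue : E.UniquelyErgodic) {x : ℝ} (hx : x ∈ E.module) :
    r.ρ * x ∈ E.module := by
  have hinv : ∀ n : ℕ, ∀ x ∈ E.module, r.ρ⁻¹ ^ n * x ∈ E.module := by
    intro n
    induction n with
    | zero => simp
    | succ n ih =>
      intro x hx
      rw [pow_succ, mul_assoc]
      exact ih _ (inv_mul_mem_module hue hx)
  obtain ⟨p, hp, hroot⟩ := isIntegral_scale (r := r) hue
  rw [← Polynomial.aeval_def, Polynomial.aeval_eq_sum_range, Finset.sum_range_succ,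
    hp.coeff_natDegree, one_smul] at hroot
  obtain ⟨d, hd⟩ : ∃ d, p.natDegree = d + 1 := by
    refine Nat.exists_eq_succ_of_ne_zero fun h0 => ?_
    simp [h0] at hroot
  rw [hd] at hroot
  have hρ := r.ρ_pos.ne'
  have h1 : r.ρ * x = -∑ i ∈ Finset.range (d + 1), p.coeff i • (r.ρ⁻¹ ^ (d - i) * x) := by
    have h2 : r.ρ * x = r.ρ ^ (d + 1) * (r.ρ⁻¹ ^ d * x) := by
      rw [pow_succ', mul_assoc, ← mul_assoc (r.ρ ^ d), ← mul_pow, mul_inv_cancel₀ hρ, one_pow,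
        one_mul]
    rw [h2, eq_neg_of_add_eq_zero_right hroot, neg_mul, Finset.sum_mul]
    congr 1
    refine Finset.sum_congr rfl fun i hi => ?_
    rw [smul_mul_assoc, ← mul_assoc]
    obtain ⟨e, rfl⟩ := Nat.exists_eq_add_of_le (Nat.lt_succ_iff.1 (Finset.mem_range.1 hi))
    rw [Nat.add_sub_cancel_left, pow_add, ← mul_assoc, ← mul_pow, mul_inv_cancel₀ hρ, one_pow,
      one_mul]
  rw [h1]
  exact Submodule.neg_mem _ (Submodule.sum_mem _ fun i _ =>
    Submodule.smul_mem _ _ (hinv _ _ hx))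

lemma pow_mul_mem_module (hue : E.UniquelyErgodic) (n : ℕ) {x : ℝ} (hx : x ∈ E.module) :
    r.ρ ^ n * x ∈ E.module := by
  induction n with
  | zero => simpa using hx
  | succ n ih => rw [pow_succ', mul_assoc]; exact mul_mem_module hue ih

lemma scale_mem_field (hue : E.UniquelyErgodic) : r.ρ ∈ E.field := by
  have := mul_mem_module (r := r) hue E.one_mem_module
  rw [mul_one] at this
  exact mem_field_of_mem_module this

/-- The left endpoint of an atom is the left endpoint of a tile, which expresses `a` by elements
of the module. -/
lemma a_mem_module (hue : E.UniquelyErgodic) : r.a ∈ E.module := by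
  obtain ⟨i, -⟩ := E.exists_mem_atom (x := 0) ⟨le_rfl, one_pos⟩
  obtain ⟨p, y, hy, h⟩ := r.exists_tile hue (E.atom_subset i (E.left_mem_atom i))
  have hy0 : y = E.left p.exponent := by
    refine le_antisymm ?_ hy.1
    have h1 := r.tileMap_mem p (E.left_mem_atom p.exponent)
    have h2 := r.tileMap_mem p hy
    rw [h] at h2
    rw [E.atom_unique h2 (E.left_mem_atom i)] at h1
    have h3 := r.tileMap_sub p (E.left p.exponent) y
    rw [h] at h3
    have h4 : 0 ≤ r.ρ * (E.left p.exponent - y) := h3 ▸ sub_nonneg.2 h1.1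
    exact sub_nonneg.1 (nonneg_of_mul_nonneg_right h4 r.ρ_pos)
  have ha : r.a = E.left i - r.ρ * E.left p.exponent - p.trans := by
    rw [← h, hy0, Prefix.tileMap]
    ring
  rw [ha]
  exact Submodule.sub_mem _ (Submodule.sub_mem _ (E.left_mem_module i)
    (mul_mem_module hue (E.left_mem_module _))) (prefix_trans_mem_module p)

/-! ### The layers of eventually periodic points -/

lemma sub_pow_mul_mem_module (hue : E.UniquelyErgodic) (k : ℕ) (z : ℝ) :
    z - r.ρ ^ k * r.desub^[k] z ∈ E.module := by
  induction k generalizing z with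
  | zero => simp
  | succ k ih =>
    have h := r.tileMap_desub z
    rw [Prefix.tileMap] at h
    have h1 : z - r.ρ ^ (k + 1) * r.desub^[k + 1] z = r.a + (r.address z).trans +
        r.ρ * (r.desub z - r.ρ ^ k * r.desub^[k] (r.desub z)) := by
      rw [Function.iterate_succ_apply]
      linear_combination -h
    rw [h1]
    exact Submodule.add_mem _ (Submodule.add_mem _ (a_mem_module hue) (prefix_trans_mem_module _))
      (mul_mem_module hue (ih _))

/-- Preimages of a periodic point, under iterates whose order is a multiple of the period, lie in
its layer. -/
lemma sub_mem_module_of_periodic (hue : E.UniquelyErgodic) {T : ℕ} {y z : ℝ}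
    (hy : r.desub^[T] y = y) {q : ℕ} (hz : r.desub^[T * q] z = y) : z - y ∈ E.module := by
  have hyq : r.desub^[T * q] y = y := by
    rw [Function.iterate_mul]
    exact Function.iterate_fixed hy q
  have h1 := sub_pow_mul_mem_module (r := r) hue (T * q) z
  have h2 := sub_pow_mul_mem_module (r := r) hue (T * q) y
  rw [hz] at h1
  rw [hyq] at h2
  simpa using Submodule.sub_mem _ h1 h2

/-- A periodic point is a rational combination of the basis of the module: multiplication by
`1 - ρ ^ T`, which maps the point into the module, is invertible on the rational span. -/
lemma exists_rat_of_periodic (hue : E.UniquelyErgodic) {ι : Type} [Fintype ι]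
    (ν : Module.Basis ι ℤ E.module) {T : ℕ} (hT : 0 < T) {y : ℝ} (hy : r.desub^[T] y = y) :
    ∃ q : ι → ℚ, y = ∑ k, (q k : ℝ) * (ν k : ℝ) := by
  set V : Submodule ℚ ℝ := Submodule.span ℚ (Set.range fun k => (ν k : ℝ)) with hVdef
  have hMV : ∀ x ∈ E.module, x ∈ V := by
    intro x hx
    have h := congrArg (Subtype.val) (ν.sum_repr ⟨x, hx⟩)
    rw [← show _ = x from h, AddSubmonoidClass.coe_finsetSum]
    refine Submodule.sum_mem _ fun k _ => ?_
    rw [SetLike.val_smul]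
    exact zsmul_mem (Submodule.subset_span (Set.mem_range_self k)) _
  have hV : ∀ x ∈ V, LinearMap.mulLeft ℚ (1 - r.ρ ^ T) x ∈ V := by
    intro x hx
    rw [LinearMap.mulLeft_apply]
    induction hx using Submodule.span_induction with
    | mem x hx =>
      obtain ⟨k, rfl⟩ := hx
      refine hMV _ ?_
      rw [sub_mul, one_mul]
      exact Submodule.sub_mem _ (ν k).2 (pow_mul_mem_module hue T (ν k).2)
    | zero => simp
    | add x y _ _ hx hy => rw [mul_add]; exact Submodule.add_mem _ hx hy
    | smul a x _ hx => rw [mul_smul_comm]; exact Submodule.smul_mem _ _ hx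
  have hne : 1 - r.ρ ^ T ≠ 0 := (sub_pos.2 (pow_lt_one₀ r.ρ_pos.le r.ρ_lt_one hT.ne')).ne'
  have hfd : FiniteDimensional ℚ V := FiniteDimensional.span_of_finite ℚ (Set.finite_range _)
  have hinj : Function.Injective ((LinearMap.mulLeft ℚ (1 - r.ρ ^ T)).restrict hV) := by
    intro u v huv
    have h := congrArg Subtype.val huv
    exact Subtype.ext (mul_left_cancel₀ hne h)
  have hy1 : (1 - r.ρ ^ T) * y ∈ V := by
    have h := sub_pow_mul_mem_module (r := r) hue T y
    rw [hy] at h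
    rw [sub_mul, one_mul]
    exact hMV _ h
  obtain ⟨v, hv⟩ := LinearMap.injective_iff_surjective.1 hinj ⟨_, hy1⟩
  have hvy : (v : ℝ) = y := mul_left_cancel₀ hne (congrArg Subtype.val hv)
  obtain ⟨q, hq⟩ := (Submodule.mem_span_range_iff_exists_fun ℚ).1 v.2
  refine ⟨q, ?_⟩
  rw [← hvy, ← hq]
  exact Finset.sum_congr rfl fun k _ => Rat.smul_def _ _

lemma exists_layerRep_of_periodic (hue : E.UniquelyErgodic) {ι : Type} [Fintype ι]
    (ν : Module.Basis ι ℤ E.module) {T : ℕ} (hT : 0 < T) {y : ℝ} (hy : r.desub^[T] y = y) :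
    ∃ ξ ∈ E.layerReps ν, y - ξ ∈ E.module := by
  obtain ⟨q, rfl⟩ := exists_rat_of_periodic hue ν hT hy
  refine ⟨_, ⟨fun k => Int.fract (q k), fun k => ⟨Int.fract_nonneg _, Int.fract_lt_one _⟩, rfl⟩, ?_⟩
  rw [← Finset.sum_sub_distrib]
  refine Submodule.sum_mem _ fun k _ => ?_
  have h : (q k : ℝ) * (ν k : ℝ) - ((Int.fract (q k) : ℚ) : ℝ) * (ν k : ℝ) =
      ⌊q k⌋ • (ν k : ℝ) := by
    rw [← sub_mul, zsmul_eq_mul, Int.fract]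
    push_cast
    ring
  rw [h]
  exact Submodule.smul_mem _ _ (ν k).2

end Renormalization

end IET

/-! ### Spectral radii of the two matrices -/

lemma mem_spectrum_iff_exists_vecMul {ι : Type} [Fintype ι] [DecidableEq ι] (A : Matrix ι ι ℂ)
    (c : ℂ) : c ∈ spectrum ℂ A ↔ ∃ v : ι → ℂ, v ≠ 0 ∧ Matrix.vecMul v A = c • v := by
  rw [spectrum.mem_iff, Matrix.isUnit_iff_isUnit_det, isUnit_iff_ne_zero, not_not,
    ← Matrix.exists_vecMul_eq_zero_iff]
  refine exists_congr fun v => and_congr_right fun _ => ?_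
  rw [Matrix.vecMul_sub, sub_eq_zero, Algebra.algebraMap_eq_smul_one, Matrix.vecMul_smul,
    Matrix.vecMul_one, eq_comm]

lemma mem_spectrum_of_mulVec {ι : Type} [Fintype ι] [DecidableEq ι] {A : Matrix ι ι ℂ}
    {c : ℂ} {v : ι → ℂ} (hv : v ≠ 0) (h : A.mulVec v = c • v) : c ∈ spectrum ℂ A := by
  rw [spectrum.mem_iff, Matrix.isUnit_iff_isUnit_det, isUnit_iff_ne_zero, not_not,
    ← Matrix.exists_mulVec_eq_zero_iff]
  refine ⟨v, hv, ?_⟩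
  rw [Matrix.sub_mulVec, Algebra.algebraMap_eq_smul_one, Matrix.smul_mulVec, Matrix.one_mulVec,
    h, sub_self]

namespace IET

variable {N : ℕ} {E : IET N}

namespace Renormalization

variable {r : E.Renormalization}

/-- The spectral radius of the incidence matrix is the eigenvalue of the positive eigenvector
formed by the lengths. -/
lemma specNorm_incidence (hue : E.UniquelyErgodic) :
    specNorm r.incidence = ENNReal.ofReal r.ρ⁻¹ := by
  have hinv : 0 < r.ρ⁻¹ := inv_pos.2 r.ρ_pos
  refine le_antisymm (iSup₂_le fun c hc => ?_) ?_
  · obtain ⟨v, hv, h⟩ := (mem_spectrum_iff_exists_vecMul _ c).1 hc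
    have hj : ∀ j, ‖c‖ * ‖v j‖ ≤ ∑ i, ‖v i‖ * (r.incidence i j : ℝ) := by
      intro j
      have h1 := congrFun h j
      rw [Pi.smul_apply, smul_eq_mul] at h1
      rw [← norm_mul, ← h1]
      refine (norm_sum_le Finset.univ fun i => v i * ((r.incidence i j : ℤ) : ℂ)).trans
        (Finset.sum_le_sum fun i _ => ?_)
      rw [norm_mul, Complex.norm_intCast, abs_of_nonneg]
      exact Int.cast_nonneg (Int.natCast_nonneg _)
    have hpos : 0 < ∑ i, ‖v i‖ * E.len i := by
      obtain ⟨i, hi⟩ := Function.ne_iff.1 hv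
      exact Finset.sum_pos' (fun k _ => mul_nonneg (norm_nonneg _) (E.len_pos k).le)
        ⟨i, Finset.mem_univ i, mul_pos (norm_pos_iff.2 hi) (E.len_pos i)⟩
    have hle : ‖c‖ * ∑ i, ‖v i‖ * E.len i ≤ r.ρ⁻¹ * ∑ i, ‖v i‖ * E.len i := by
      calc ‖c‖ * ∑ i, ‖v i‖ * E.len i = ∑ j, ‖c‖ * ‖v j‖ * E.len j := by
            rw [Finset.mul_sum]
            exact Finset.sum_congr rfl fun j _ => by ring
        _ ≤ ∑ j, (∑ i, ‖v i‖ * (r.incidence i j : ℝ)) * E.len j :=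
            Finset.sum_le_sum fun j _ => mul_le_mul_of_nonneg_right (hj j) (E.len_pos j).le
        _ = ∑ i, ‖v i‖ * ∑ j, (r.incidence i j : ℝ) * E.len j := by
            simp only [Finset.sum_mul, Finset.mul_sum]
            rw [Finset.sum_comm]
            exact Finset.sum_congr rfl fun i _ => Finset.sum_congr rfl fun j _ => by ring
        _ = r.ρ⁻¹ * ∑ i, ‖v i‖ * E.len i := by
            rw [Finset.mul_sum]
            exact Finset.sum_congr rfl fun i _ => by rw [incidence_mul_len hue i]; ring
    change ‖c‖ₑ ≤ _
    rw [← ofReal_norm]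
    exact ENNReal.ofReal_le_ofReal (le_of_mul_le_mul_right hle hpos)
  · have hmem : ((r.ρ⁻¹ : ℝ) : ℂ) ∈ spectrum ℂ (r.incidence.map (Int.cast : ℤ → ℂ)) := by
      refine mem_spectrum_of_mulVec (v := fun i => (E.len i : ℂ)) ?_ ?_
      · obtain ⟨i, -⟩ := E.exists_mem_atom (x := 0) ⟨le_rfl, one_pos⟩
        exact Function.ne_iff.2 ⟨i, Complex.ofReal_ne_zero.2 (E.len_pos i).ne'⟩
      · ext i
        have h := congrArg (Complex.ofReal) (incidence_mul_len (r := r) hue i)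
        push_cast at h
        simpa [Matrix.mulVec, dotProduct] using h
    have h2 : (‖((r.ρ⁻¹ : ℝ) : ℂ)‖₊ : ENNReal) ≤ specNorm r.incidence :=
      le_iSup₂ (f := fun (k : ℂ) (_ : k ∈ spectrum ℂ (r.incidence.map (Int.cast : ℤ → ℂ))) =>
        (‖k‖₊ : ENNReal)) _ hmem
    refine le_trans (le_of_eq ?_) h2
    rw [← enorm_eq_nnnorm, ← ofReal_norm, Complex.norm_real, Real.norm_of_nonneg hinv.le]

/-- The conjugates of the scaling factor are eigenvalues of the matrix of its multiplication. -/
lemma enorm_embedding_le_specNorm (hue : E.UniquelyErgodic) {ι : Type} [Fintype ι] [DecidableEq ι]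
    (ν : Module.Basis ι ℤ E.module) (φ : E.field →ₐ[ℚ] ℂ) :
    ‖φ ⟨r.ρ, scale_mem_field hue⟩‖ₑ ≤ specNorm (r.scalingMatrix ν) := by
  have key : ∀ m : E.module, φ ⟨m, mem_field_of_mem_module m.2⟩ =
      ∑ i, φ ⟨ν i, mem_field_of_mem_module (ν i).2⟩ * (ν.repr m i : ℂ) := by
    intro m
    have h : (⟨m, mem_field_of_mem_module m.2⟩ : E.field) =
        ∑ i, ν.repr m i • ⟨ν i, mem_field_of_mem_module (ν i).2⟩ := by
      refine Subtype.ext ?_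
      have h1 := congrArg Subtype.val (ν.sum_repr m)
      rw [AddSubmonoidClass.coe_finsetSum] at h1 ⊢
      rw [← h1]
      rfl
    rw [h, map_sum]
    exact Finset.sum_congr rfl fun i _ => by rw [map_zsmul, zsmul_eq_mul, mul_comm]
  have hmem : φ ⟨r.ρ, scale_mem_field hue⟩ ∈
      spectrum ℂ ((r.scalingMatrix ν).map (Int.cast : ℤ → ℂ)) := by
    refine (mem_spectrum_iff_exists_vecMul _ _).2
      ⟨fun i => φ ⟨ν i, mem_field_of_mem_module (ν i).2⟩, fun h0 => ?_, ?_⟩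
    · have h1 := key ⟨1, E.one_mem_module⟩
      have h2 : ∀ i, φ ⟨ν i, mem_field_of_mem_module (ν i).2⟩ = 0 := fun i => congrFun h0 i
      simp only [h2, zero_mul, Finset.sum_const_zero] at h1
      exact one_ne_zero ((map_one φ).symm.trans h1)
    · ext j
      have hj := mul_mem_module (r := r) hue (ν j).2
      have h1 := key ⟨_, hj⟩
      have h2 : φ ⟨r.ρ * (ν j : ℝ), mem_field_of_mem_module hj⟩ =
          φ ⟨r.ρ, scale_mem_field hue⟩ * φ ⟨ν j, mem_field_of_mem_module (ν j).2⟩ := by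
        rw [← map_mul]
        rfl
      rw [Pi.smul_apply, smul_eq_mul, ← h2, h1]
      refine Finset.sum_congr rfl fun i _ => ?_
      change φ ⟨ν i, mem_field_of_mem_module (ν i).2⟩ * ((r.scalingMatrix ν i j : ℤ) : ℂ) = _
      rw [scalingMatrix, dif_pos hj]
  exact le_iSup₂ (f := fun (k : ℂ)
    (_ : k ∈ spectrum ℂ ((r.scalingMatrix ν).map (Int.cast : ℤ → ℂ))) => (‖k‖₊ : ENNReal)) _ hmem

/-! ### Conjugates and coordinates of the preimages of a point -/

lemma mem_field_of_iterate_desub (hue : E.UniquelyErgodic) {k : ℕ} {z : ℝ}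
    (h : r.desub^[k] z ∈ E.field) : z ∈ E.field := by
  have h1 := mem_field_of_mem_module (sub_pow_mul_mem_module (r := r) hue k z)
  have h2 := E.field.mul_mem (pow_mem (scale_mem_field (r := r) hue) k) h
  simpa using E.field.add_mem h1 h2

/-- The conjugates of preimages of order `k` are bounded by a multiple of `Λ ^ k`, where `Λ > 1`
bounds the conjugates of the scaling factor. -/
lemma exists_norm_embedding_le (hue : E.UniquelyErgodic) (φ : E.field →ₐ[ℚ] ℂ) {Λ : ℝ}
    (hΛ : 1 < Λ) (hφ : ‖φ ⟨r.ρ, scale_mem_field hue⟩‖ ≤ Λ) (y : E.field) :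
    ∃ C, ∀ k, ∀ z : E.field, r.desub^[k] (z : ℝ) = y → ‖φ z‖ ≤ C * Λ ^ k := by
  have hmem : ∀ p : r.Prefix, r.a + p.trans ∈ E.field := fun p => mem_field_of_mem_module
    (Submodule.add_mem _ (a_mem_module hue) (prefix_trans_mem_module p))
  set B : ℝ := ∑ p : r.Prefix, ‖φ ⟨r.a + p.trans, hmem p⟩‖ with hB
  have hBle : ∀ p : r.Prefix, ‖φ ⟨r.a + p.trans, hmem p⟩‖ ≤ B := fun p =>
    Finset.single_le_sum (f := fun p : r.Prefix => ‖φ ⟨r.a + p.trans, hmem p⟩‖)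
      (fun p _ => norm_nonneg _) (Finset.mem_univ p)
  have hB0 : 0 ≤ B := Finset.sum_nonneg fun p _ => norm_nonneg _
  -- `c` is the fixed point of `t ↦ Λ t - B`
  set c : ℝ := B / (Λ - 1) with hc
  have hcB : B + c = Λ * c := by
    have : Λ - 1 ≠ 0 := (sub_pos.2 hΛ).ne'
    rw [hc]
    field_simp
    ring
  have hc0 : 0 ≤ c := div_nonneg hB0 (sub_pos.2 hΛ).le
  refine ⟨‖φ y‖ + c, fun k z hz => ?_⟩
  suffices h : ‖φ z‖ + c ≤ (‖φ y‖ + c) * Λ ^ k by linarith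
  induction k generalizing z with
  | zero =>
    have : z = y := Subtype.ext hz
    rw [this, pow_zero, mul_one]
  | succ k ih =>
    rw [Function.iterate_succ_apply] at hz
    have hw : r.desub z ∈ E.field := mem_field_of_iterate_desub hue (hz ▸ y.2)
    have h1 := ih ⟨r.desub z, hw⟩ hz
    have h2 : z = ⟨r.a + (r.address z).trans, hmem _⟩ +
        ⟨r.ρ, scale_mem_field hue⟩ * ⟨r.desub z, hw⟩ := by
      refine Subtype.ext ?_
      have h := r.tileMap_desub z
      rw [Prefix.tileMap] at h
      change (z : ℝ) = r.a + (r.address z).trans + r.ρ * r.desub z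
      linear_combination -h
    have h3 : ‖φ z‖ ≤ B + Λ * ‖φ ⟨r.desub z, hw⟩‖ := by
      rw [(congrArg φ h2).trans (by rw [map_add, map_mul])]
      refine (norm_add_le _ _).trans (add_le_add (hBle _) ?_)
      rw [norm_mul]
      exact mul_le_mul_of_nonneg_right hφ (norm_nonneg _)
    have h4 := mul_le_mul_of_nonneg_left h1 (zero_le_one.trans hΛ.le)
    rw [pow_succ]
    linarith

end Renormalization

/-- The coordinates of an element of the module are bounded by its conjugates: a coordinate
extends to a linear functional on the field, which is `x ↦ Tr (β x)` for some `β`. -/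
lemma exists_abs_repr_le [FiniteDimensional ℚ E.field] {ι : Type}
    (ν : Module.Basis ι ℤ E.module) (i : ι) :
    ∃ w : (E.field →ₐ[ℚ] ℂ) → ℝ, (∀ φ, 0 ≤ w φ) ∧ ∀ m : E.module, |(ν.repr m i : ℝ)| ≤
      ∑ φ : E.field →ₐ[ℚ] ℂ, w φ * ‖φ ⟨m, mem_field_of_mem_module m.2⟩‖ := by
  set emb : E.module →ₗ[ℤ] E.field :=
    { toFun := fun m => ⟨m, mem_field_of_mem_module m.2⟩
      map_add' := fun _ _ => rfl
      map_smul' := fun c m => Subtype.ext (by simp) } with hemb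
  have hinj : Function.Injective emb := fun x y h => 
    Subtype.ext (congrArg (fun t : E.field => (t : ℝ)) h)
  have hli : LinearIndependent ℚ (emb ∘ ν) :=
    (LinearIndependent.iff_fractionRing ℤ ℚ).1
      (ν.linearIndependent.map' emb (LinearMap.ker_eq_bot.2 hinj))
  obtain ⟨g, hg⟩ := LinearMap.exists_extend ((Finsupp.lapply i).comp hli.repr)
  have hgν : ∀ k, g (emb (ν k)) = Finsupp.single k (1 : ℚ) i := by
    intro k
    have h1 := LinearMap.congr_fun hg ⟨emb (ν k), Submodule.subset_span ⟨k, rfl⟩⟩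
    have h2 := hli.repr_eq_single k ⟨emb (ν k), Submodule.subset_span ⟨k, rfl⟩⟩ rfl
    rw [LinearMap.comp_apply, LinearMap.comp_apply, h2] at h1
    exact h1
  have hgm : ∀ m, g (emb m) = (ν.repr m i : ℚ) := by
    intro m
    have h : (g.restrictScalars ℤ).comp emb =
        (Algebra.linearMap ℤ ℚ).comp ((Finsupp.lapply i).comp ν.repr.toLinearMap) := by
      refine ν.ext fun k => ?_
      simp only [LinearMap.comp_apply, LinearMap.restrictScalars_apply, hgν]
      by_cases hk : k = i
      · simp [hk]
      · simp [hk]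
    simpa using LinearMap.congr_fun h m
  have hnd := traceForm_nondegenerate ℚ E.field
  set β := (LinearMap.BilinForm.toDual _ hnd).symm g with hβ
  have hβg : ∀ x, Algebra.trace ℚ E.field (β * x) = g x := fun x =>
    LinearMap.BilinForm.apply_toDual_symm_apply (hB := hnd) g x
  refine ⟨fun φ => ‖φ β‖, fun φ => norm_nonneg _, fun m => ?_⟩
  have h1 := trace_eq_sum_embeddings ℂ (K := ℚ) (x := β * emb m)
  rw [hβg, hgm] at h1
  have h2 : |(ν.repr m i : ℝ)| = ‖(algebraMap ℚ ℂ) (ν.repr m i : ℚ)‖ := by simp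
  rw [h2, h1]
  refine (norm_sum_le _ _).trans (Finset.sum_le_sum fun φ _ => ?_)
  rw [map_mul, norm_mul]
  rfl

end IET

namespace IET

variable {N : ℕ} {E : IET N}

/-! ### Counting points in boxes -/

/-- The boxes contain finitely many points of `[0, 1)`: the coordinate that a box leaves free is
the coefficient of `1 / b`, and is bounded because the points are. -/
lemma finite_box {ι : Type} [Fintype ι] (ν : Module.Basis ι ℤ E.module) {o : ι} {b : ℕ}
    (h : E.IsReducedBasis ν o b) (ξ : ℝ) (A : Set ℝ) (k : ℕ) :
    {x : ℝ | x ∈ A ∧ x ∈ Ico (0 : ℝ) 1 ∧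
      ∃ m : E.module, x = ξ + (m : ℝ) ∧ ∀ i, i ≠ o → |ν.repr m i| ≤ (k : ℤ)}.Finite := by
  classical
  have hb : (0 : ℝ) < b := by exact_mod_cast h.1
  set X : ℝ := b * (1 + |ξ| + ∑ i ∈ Finset.univ.erase o, k * |(ν i : ℝ)|) with hX
  set K : ℤ := max k ⌈X⌉ with hK
  refine ((finite_Icc (fun _ : ι => -K) (fun _ => K)).image
    fun f => ξ + ((∑ i, f i • ν i : E.module) : ℝ)).subset ?_
  rintro x ⟨-, hx, m, hxm, hm⟩
  refine ⟨fun i => ν.repr m i, ?_, ?_⟩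
  · have hle : ∀ i, |ν.repr m i| ≤ K := by
      intro i
      by_cases hio : i = o
      · subst hio
        refine le_max_of_le_right ?_
        have h1 := congrArg Subtype.val (ν.sum_repr m)
        rw [AddSubmonoidClass.coe_finsetSum, ← Finset.add_sum_erase _ _ (Finset.mem_univ i)] at h1
        simp only [SetLike.val_smul, zsmul_eq_mul] at h1
        rw [h.2] at h1
        have h2 : (ν.repr m i : ℝ) = b * (x - ξ -
            ∑ j ∈ Finset.univ.erase i, (ν.repr m j : ℝ) * (ν j : ℝ)) := by
          have h3 : (ν.repr m i : ℝ) = b * ((ν.repr m i : ℝ) * (1 / b)) := by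
            field_simp
          rw [h3, hxm]
          congr 1
          linear_combination h1
        have h4 : |(ν.repr m i : ℝ)| ≤ X := by
          rw [h2, abs_mul, abs_of_pos hb, hX]
          refine mul_le_mul_of_nonneg_left ((abs_sub _ _).trans (add_le_add
            ((abs_sub _ _).trans (add_le_add ?_ le_rfl)) ?_)) hb.le
          · rw [abs_of_nonneg hx.1]
            exact hx.2.le
          · refine (Finset.abs_sum_le_sum_abs _ _).trans (Finset.sum_le_sum fun j hj => ?_)
            rw [abs_mul]
            refine mul_le_mul_of_nonneg_right ?_ (abs_nonneg _)
            exact_mod_cast hm j (Finset.ne_of_mem_erase hj)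
        exact_mod_cast h4.trans (Int.le_ceil X)
      · exact (hm i hio).trans (le_max_left _ _)
    exact ⟨fun i => (abs_le.1 (hle i)).1, fun i => (abs_le.1 (hle i)).2⟩
  · change ξ + ((∑ i, ν.repr m i • ν i : E.module) : ℝ) = x
    rw [ν.sum_repr, hxm]

namespace Renormalization

variable {r : E.Renormalization}

/-- The coordinates, relative to the layer of a periodic point, of its preimages of order `k` are
bounded by a multiple of `Λ ^ k`. -/
lemma exists_abs_repr_preimage_le (hue : E.UniquelyErgodic) [FiniteDimensional ℚ E.field]
    {ι : Type} [Fintype ι] (ν : Module.Basis ι ℤ E.module) {Λ : ℝ} (hΛ : 1 < Λ)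
    (hφ : ∀ φ : E.field →ₐ[ℚ] ℂ, ‖φ ⟨r.ρ, scale_mem_field hue⟩‖ ≤ Λ) {y ξ : ℝ}
    (hy : y ∈ E.field) (hξ : ξ ∈ E.field) :
    ∃ C, 1 ≤ C ∧ ∀ k, ∀ m : E.module, r.desub^[k] (ξ + m) = y →
      ∀ i, |(ν.repr m i : ℝ)| ≤ C * Λ ^ k := by
  choose w hw0 hw using exists_abs_repr_le ν
  choose C hC using fun φ => exists_norm_embedding_le (r := r) hue φ hΛ (hφ φ) ⟨y, hy⟩
  set D : ι → ℝ := fun i => ∑ φ, w i φ * (C φ + ‖φ ⟨ξ, hξ⟩‖) with hD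
  have hmain : ∀ k, ∀ m : E.module, r.desub^[k] (ξ + m) = y →
      ∀ i, |(ν.repr m i : ℝ)| ≤ D i * Λ ^ k := by
    intro k m hm i
    refine (hw i m).trans ?_
    rw [hD, Finset.sum_mul]
    refine Finset.sum_le_sum fun φ _ => ?_
    rw [mul_assoc]
    refine mul_le_mul_of_nonneg_left ?_ (hw0 i φ)
    have hmK := mem_field_of_mem_module m.2
    have h1 := hC φ k ⟨ξ + m, E.field.add_mem hξ hmK⟩ hm
    have h2 : φ ⟨m, hmK⟩ = φ ⟨ξ + m, E.field.add_mem hξ hmK⟩ - φ ⟨ξ, hξ⟩ := by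
      rw [← map_sub]
      exact congrArg φ (Subtype.ext (add_sub_cancel_left ξ (m : ℝ)).symm)
    rw [h2, add_mul]
    refine (norm_sub_le _ _).trans (add_le_add h1 ?_)
    exact le_mul_of_one_le_right (norm_nonneg _) (one_le_pow₀ hΛ.le)
  refine ⟨1 + ∑ i, |D i|, le_add_of_nonneg_right (Finset.sum_nonneg fun i _ => abs_nonneg _),
    fun k m hm i => (hmain k m hm i).trans ?_⟩
  refine mul_le_mul_of_nonneg_right ?_ (pow_pos (zero_lt_one.trans hΛ) k).le
  have h1 := Finset.single_le_sum (f := fun i => |D i|) (fun i _ => abs_nonneg _)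
    (Finset.mem_univ i)
  have h2 := le_abs_self (D i)
  linarith

/-- The preimages of a periodic point, of all orders that are multiples of the period, form a set
of positive density in the layer of the point: their coordinates grow at the rate `Λ = ‖R‖`,
their number at the rate `ρ⁻¹ = ‖M_σ‖ = Λ ^ (n - 1)`. -/
lemma exists_hasPositiveDensity (hue : E.UniquelyErgodic) (halg : E.IsAlgebraic)
    {ι : Type} [Fintype ι] [DecidableEq ι] (ν : Module.Basis ι ℤ E.module)
    (hnorm : specNorm (r.scalingMatrix ν) ^ (E.degree - 1) = specNorm r.incidence)
    {T : ℕ} (hT : 0 < T) {y : ℝ} (hy : y ∈ Ico (0 : ℝ) 1) (hper : r.desub^[T] y = y)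
    {A : Set ℝ} (hA : ∀ k, ∀ z ∈ Ico (0 : ℝ) 1, r.desub^[k] z = y → z ∈ A) :
    ∃ ξ ∈ E.layerReps ν, E.HasPositiveDensity ι ξ A := by
  have : FiniteDimensional ℚ E.field := halg
  obtain ⟨ξ, hξ, hyξ⟩ := exists_layerRep_of_periodic hue ν hT hper
  refine ⟨ξ, hξ, fun ν' o b hν' => ?_⟩
  have hρ := r.ρ_pos
  set n := E.degree - 1 with hn
  have hρ1 : 1 < r.ρ⁻¹ := (one_lt_inv₀ hρ).2 r.ρ_lt_one
  rw [specNorm_incidence hue] at hnorm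
  have hn0 : n ≠ 0 := by
    intro h0
    rw [h0, pow_zero, eq_comm, ENNReal.ofReal_eq_one] at hnorm
    exact hρ1.ne' hnorm
  have hfin : specNorm (r.scalingMatrix ν) ≠ ⊤ := by
    intro h
    rw [h, ENNReal.top_pow hn0] at hnorm
    exact ENNReal.ofReal_ne_top hnorm.symm
  set Λ : ℝ := (specNorm (r.scalingMatrix ν)).toReal with hΛdef
  have hΛn : Λ ^ n = r.ρ⁻¹ := by
    rw [hΛdef, ← ENNReal.toReal_pow, hnorm, ENNReal.toReal_ofReal (inv_pos.2 hρ).le]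
  have hΛ : 1 < Λ := by
    by_contra hle
    exact absurd (hΛn ▸ hρ1) (not_lt.2 (pow_le_one₀ ENNReal.toReal_nonneg (not_lt.1 hle)))
  have hΛ0 : 0 < Λ := zero_lt_one.trans hΛ
  have hφ : ∀ φ : E.field →ₐ[ℚ] ℂ, ‖φ ⟨r.ρ, scale_mem_field hue⟩‖ ≤ Λ := by
    intro φ
    rw [← toReal_enorm]
    exact ENNReal.toReal_mono hfin (enorm_embedding_le_specNorm hue ν φ)
  have hyK : y ∈ E.field := by
    obtain ⟨q, rfl⟩ := exists_rat_of_periodic hue ν hT hper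
    exact sum_mem fun k _ => E.field.mul_mem (SubfieldClass.ratCast_mem _ _)
      (mem_field_of_mem_module (ν k).2)
  have hξK : ξ ∈ E.field := by
    have := E.field.sub_mem hyK (mem_field_of_mem_module hyξ)
    rwa [sub_sub_cancel] at this
  obtain ⟨C, hC1, hC⟩ := exists_abs_repr_preimage_le (r := r) hue ν' hΛ hφ hyK hξK
  have hC0 : 0 < C := zero_lt_one.trans_le hC1
  obtain ⟨c, hc, hcount⟩ := exists_le_height (r := r) hue
  obtain ⟨j, hj⟩ := E.exists_mem_atom hy
  have hb : (0 : ℝ) < b := by exact_mod_cast hν'.1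
  refine ⟨c * r.ρ ^ T / (b * (2 * C) ^ n), by positivity, ?_⟩
  filter_upwards [eventually_ge_atTop ⌈C⌉₊] with k hk
  have hkC : C ≤ k := Nat.ceil_le.1 hk
  have hk0 : (0 : ℝ) < k := hC0.trans_le hkC
  -- the largest order of preimages whose coordinates are known to fit into the box
  obtain ⟨q, hq1, hq2⟩ := exists_nat_pow_near ((one_le_div hC0).2 hkC)
    (one_lt_pow₀ hΛ hT.ne')
  rw [← pow_mul, le_div_iff₀ hC0, mul_comm] at hq1
  obtain ⟨s, hs, hs'⟩ := exists_preimages (r := r) hue (T * q) hj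
  have hbox : r.height (T * q) j ≤ E.boxCount ν' o ξ A k := by
    rw [← hs, ← ncard_coe_finset]
    refine ncard_le_ncard (fun z hz => ?_) (finite_box ν' hν' ξ A k)
    obtain ⟨hz1, hz2⟩ := (hs' z).1 hz
    have hm : z - ξ ∈ E.module := by
      have := Submodule.add_mem _ (sub_mem_module_of_periodic hue hper hz2) hyξ
      rwa [sub_add_sub_cancel] at this
    refine ⟨hA _ z hz1 hz2, hz1, ⟨z - ξ, hm⟩, (add_sub_cancel ξ z).symm, fun i _ => ?_⟩
    have h1 := hC (T * q) ⟨z - ξ, hm⟩ (by rw [add_sub_cancel, hz2]) i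
    exact_mod_cast h1.trans hq1
  have hlow : c * r.ρ ^ T * (k / C) ^ n ≤ E.boxCount ν' o ξ A k := by
    calc c * r.ρ ^ T * (k / C) ^ n ≤ c * r.ρ ^ T * ((Λ ^ T) ^ (q + 1)) ^ n := by
          gcongr
      _ = c * r.ρ⁻¹ ^ (T * q) := by
          have h1 : ((Λ ^ T) ^ (q + 1)) ^ n = r.ρ⁻¹ ^ T * r.ρ⁻¹ ^ (T * q) := by
            rw [← hΛn, ← pow_mul, ← pow_mul, ← pow_mul, ← pow_mul, ← pow_add]
            congr 1
            ring
          rw [h1, mul_assoc, ← mul_assoc (r.ρ ^ T), ← mul_pow, mul_inv_cancel₀ hρ.ne', one_pow,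
            one_mul]
      _ ≤ r.height (T * q) j := hcount _ _
      _ ≤ _ := by exact_mod_cast hbox
  rw [le_div_iff₀ (by positivity)]
  refine le_trans (le_of_eq ?_) hlow
  rw [mul_pow, mul_pow, div_pow]
  field_simp

end Renormalization

end IET

theorem proposition10 {N : ℕ} (E : IET N) (hirr : E.Irreducible) (hue : E.UniquelyErgodic)
    (halg : E.IsAlgebraic) (r : E.Renormalization)
    {ι : Type} [Fintype ι] [DecidableEq ι] (ν : Module.Basis ι ℤ E.module)
    (hnorm : IET.specNorm (r.scalingMatrix ν) ^ (E.degree - 1) = IET.specNorm r.incidence)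
    (T : ℕ) (hT : 0 < T) :
    ((r.a + r.ρ = 1 → ∃ x ∈ Set.Ico (0 : ℝ) 1, r.EventuallyPeriodic T x) →
      ∃ ξ ∈ E.layerReps ν, E.HasPositiveDensity ι ξ {x | r.EventuallyPeriodic T x}) ∧
    ((∃ x ∈ Set.Ico (0 : ℝ) 1, r.EventuallyPeriodicLeast T x) →
      ∃ ξ ∈ E.layerReps ν, E.HasPositiveDensity ι ξ {x | r.EventuallyPeriodicLeast T x}) := by
  open IET.Renormalization in
  refine ⟨fun h => ?_, ?_⟩
  · have hex : ∃ x ∈ Set.Ico (0 : ℝ) 1, r.EventuallyPeriodic T x := by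
      by_cases h1 : r.a + r.ρ = 1
      · exact h h1
      · exact exists_eventuallyPeriodic hue h1 T
    obtain ⟨x, hx, hxT⟩ := hex
    obtain ⟨t, ht⟩ := exists_periodic_of_eventuallyPeriodic hue hxT
    refine exists_hasPositiveDensity hue halg ν hnorm hT (iterate_desub_mem hue hx t) ht ?_
    intro k z hz hzk
    change r.EventuallyPeriodic T z
    rw [← eventuallyPeriodic_iterate_desub_iff hue hz k, hzk]
    exact (eventuallyPeriodic_iterate_desub_iff hue hx t).2 hxT
  · rintro ⟨x, hx, hxT⟩
    obtain ⟨t, ht⟩ := exists_periodic_of_eventuallyPeriodic hue hxT.1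
    refine exists_hasPositiveDensity hue halg ν hnorm hT (iterate_desub_mem hue hx t) ht ?_
    intro k z hz hzk
    change r.EventuallyPeriodicLeast T z
    rw [← eventuallyPeriodicLeast_iterate_desub_iff hue hz k, hzk]
    exact (eventuallyPeriodicLeast_iterate_desub_iff hue hx t).2 hxT
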